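/- Let $\Omega\subset\mathbb R^2$ be an open set, $T>0$, $I_T=(0,T)$, $\mu>0$. Norms of vectors are Euclidean, norms of matrices are Frobenius, and $\boldsymbol L^p(\Omega)=L^p(\Omega;\mathbb R^2)$. Let $\boldsymbol H^1_0(\Omega)$ be the closure of $C_c^\infty(\Omega;\mathbb R^2)$ in the $H^1$ norm, $\boldsymbol V=\{\psi\in\boldsymbol H^1_0(\Omega):\operatorname{div}\psi=0\}$, and $\boldsymbol H=\{\psi\in\boldsymbol L^2(\Omega):\operatorname{div}\psi=0\text{ in }\Omega,\ \psi\cdot n=0\text{ on }\partial\Omega\}$ (understood weakly: $\int_\Omega\psi\cdot\nabla q\,dx=0$ for all $q\in H^1(\Omega)$), with $\|\psi\|_{\boldsymbol H}=\|\psi\|_{\boldsymbol L^2}$. Let $c_P,c_L>0$ be constants with $$\|v\|_{\boldsymbol L^2}\le c_P\|\nabla v\|_{\boldsymbol L^2},\qquad \|v\|_{\boldsymbol L^4}\le\sqrt{c_L}\,\|v\|_{\boldsymbol L^2}^{1/2}\|\nabla v\|_{\boldsymbol L^2}^{1/2}\qquad\text{for all } v\in\boldsymbol H^1_0(\Omega)$$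 (such constants exist, for example, if $\Omega$ is bounded). Let $\alpha:\mathbb R\to\mathbb R$ be nonnegative and Lipschitz with $\alpha(1)=0$ and $\alpha(-1)>0$, and let $\varphi\in H^1(\Omega)$ with $|\varphi|\le1$ a.e. in $\Omega$. Let $F\in L^2(I_T;\boldsymbol L^2(\Omega))$, $u_1,u_2\in L^4(I_T;\boldsymbol L^4(\Omega))$ and $\tilde u_0\in\boldsymbol H$, where for a.e. $t\in I_T$ the field $u_2(t)$ is divergence free in the sense of distributions on $\Omega$ and $u_1(t)$ has a weak gradient $\nabla u_1(t)\in L^2(\Omega;\mathbb R^{2\times2})$. Put $$a_\varphi(v,w)=\mu\int_\Omega\nabla v:\nabla w\,dx+\int_\Omega\alpha(\varphi)\,v\cdot w\,dx,\qquad b(u,v,w)=\int_\Omega[(u\cdot\nabla)v]\cdot w\,dx .$$ Let $\tilde u\in L^2(I_T;\boldsymbol V)$ with $\partial_t\tilde u\in L^2(I_T;\boldsymbol V^*)$ be a weak solution of the linearized system $$\partial_t\tilde u+\alpha(\varphi)\tilde u-\mu\Delta\tilde u+(\tilde u\cdot\nabla)u_1+(u_2\cdot\nabla)\tilde u+\nabla\tilde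 p=F,\quad \operatorname{div}\tilde u=0\ \text{ in }\Omega\times I_T,\quad \tilde u=0\ \text{ on }\partial\Omega\times I_T,\quad \tilde u(0)=\tilde u_0,$$ that is, for a.e. $t\in I_T$ and all $\psi\in\boldsymbol V$, $$\langle\partial_t\tilde u(t),\psi\rangle_{\boldsymbol V}+a_\varphi(\tilde u(t),\psi)+b(\tilde u(t),u_1(t),\psi)+b(u_2(t),\tilde u(t),\psi)=(F(t),\psi)_{\Omega},$$ and $\tilde u(t)\to\tilde u_0$ in $\boldsymbol L^2(\Omega)$ as $t\to0^+$ outside a null set of times. Suppose that there is $z\in L^2(I_T;\boldsymbol L^2(\Omega))$ with $\|\nabla u_1(t)\|_{\boldsymbol L^2}^2\le\|z(t)\|_{\boldsymbol L^2}^2$ for a.e. $t\in I_T$. Then $\tilde u$ has a representative in $C([0,T];\boldsymbol L^2(\Omega))$, again denoted $\tilde u$, with $\tilde u(0)=\tilde u_0$, and for all $t\in[0,T]$ $$\|\tilde u(t)\|_{\boldsymbol H}^2\le e^{A(t)}\|\tilde u_0\|_{\boldsymbol H}^2+\frac{2c_P^2}{\mu}\int_0^te^{A(t)-A(\tau)}\|F(\tau)\|_{\boldsymbol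 L^2}^2\,d\tau,\qquad A(t)=\frac{2c_L^2}{\mu}\int_0^t\|z(\tau)\|_{\boldsymbol L^2}^2\,d\tau-\frac{\mu}{c_P^2}\,t .$$ -/

import Mathlib

open MeasureTheory Set Filter Topology
open scoped ENNReal ContDiff

noncomputable section

namespace LinNS

/-- The plane with its Euclidean norm; points of the domain and values of vector fields. -/
abbrev E : Type := EuclideanSpace ℝ (Fin 2)

/-- `2 × 2` matrices with the Frobenius norm and inner product. -/
abbrev Mat : Type := EuclideanSpace ℝ (Fin 2 × Fin 2)

instance factOneLeFour : Fact ((1 : ℝ≥0∞) ≤ 4) := ⟨by norm_num⟩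

/-- `L²(Ω; ℝ²)`. -/
abbrev L2 (Ω : Set E) : Type := Lp E 2 (volume.restrict Ω)

/-- `L⁴(Ω; ℝ²)`. -/
abbrev L4 (Ω : Set E) : Type := Lp E 4 (volume.restrict Ω)

/-- `L²(Ω; ℝ^{2×2})`; its norm is the square root of the integral of `∑ i j, |G i j|²`. -/
abbrev L2Mat (Ω : Set E) : Type := Lp Mat 2 (volume.restrict Ω)

/-- Lebesgue measure on the time interval `(0,T)`; `f ∈ L^p(0,T;X)` is `MemLp f p (timeMeas T)`. -/
abbrev timeMeas (T : ℝ) : Measure ℝ := volume.restrict (Ioo 0 T)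

/-- Functions of class `C_c^∞(Ω; F)`. -/
def IsTest {D F : Type*} [NormedAddCommGroup D] [NormedSpace ℝ D] [NormedAddCommGroup F]
    [NormedSpace ℝ F] (Ω : Set D) (η : D → F) : Prop :=
  ContDiff ℝ ∞ η ∧ HasCompactSupport η ∧ tsupport η ⊆ Ω

/-- The classical partial derivative `∂_j η`. -/
def pd {F : Type*} [NormedAddCommGroup F] [NormedSpace ℝ F] (j : Fin 2) (η : E → F) (x : E) : F :=
  fderiv ℝ η x (EuclideanSpace.single j 1)

/-- The classical gradient of a vector field, with entries `(∇θ)_{ij} = ∂_j θ_i`. -/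
def grad (θ : E → E) (x : E) : Mat := WithLp.toLp 2 fun p => pd p.2 θ x p.1

/-- `g` is the weak partial derivative `∂_j f` on `Ω`. -/
def IsWeakPartial (Ω : Set E) (j : Fin 2) (f g : E → ℝ) : Prop :=
  ∀ η : E → ℝ, IsTest Ω η → ∫ x in Ω, f x * pd j η x = - ∫ x in Ω, g x * η x

/-- `G` is the weak gradient of the vector field `v` on `Ω`, `G_{ij} = ∂_j v_i`. -/
def IsWeakGrad (Ω : Set E) (v : E → E) (G : E → Mat) : Prop :=
  ∀ i j : Fin 2, IsWeakPartial Ω j (fun x => v x i) (fun x => G x (i, j))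

/-- `div v = 0` in the sense of distributions on `Ω`. -/
def IsDivFree (Ω : Set E) (v : E → E) : Prop :=
  ∀ η : E → ℝ, IsTest Ω η → ∫ x in Ω, ∑ j, v x j * pd j η x = 0

/-- `q ∈ H¹(Ω)` is a scalar function with weak partial derivatives `g j`. -/
def IsH1 (Ω : Set E) (q : E → ℝ) (g : Fin 2 → E → ℝ) : Prop :=
  MemLp q 2 (volume.restrict Ω) ∧
    ∀ j, MemLp (g j) 2 (volume.restrict Ω) ∧ IsWeakPartial Ω j q (g j)

/-- The admissible design functions: `φ ∈ H¹(Ω)` with `|φ| ≤ 1` a.e. -/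
def PhiAd (Ω : Set E) : Set (E → ℝ) :=
  {φ | (∃ g, IsH1 Ω φ g) ∧ ∀ᵐ x ∂(volume.restrict Ω), |φ x| ≤ 1}

/-- The solenoidal fields of `L²(Ω; ℝ²)` with vanishing normal component on `∂Ω`. Both conditions
are expressed weakly: `∫ ψ · ∇q = 0` for every `q ∈ H¹(Ω)`. -/
def IsH (Ω : Set E) (ψ : L2 Ω) : Prop :=
  ∀ q g, IsH1 Ω q g → ∫ x in Ω, ∑ j, ψ x j * g j x = 0

/-- Ambient Hilbert space of pairs `(v, ∇v)`, with `‖(v, G)‖² = ‖v‖² + ‖G‖²`. -/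
abbrev Pair (Ω : Set E) : Type := WithLp 2 (L2 Ω × L2Mat Ω)

lemma IsTest.add {D F : Type*} [NormedAddCommGroup D] [NormedSpace ℝ D] [NormedAddCommGroup F]
    [NormedSpace ℝ F] {Ω : Set D} {η θ : D → F} (h : IsTest Ω η) (k : IsTest Ω θ) :
    IsTest Ω (η + θ) :=
  ⟨h.1.add k.1, h.2.1.add k.2.1,
    (tsupport_add η θ).trans (union_subset h.2.2 k.2.2)⟩

lemma IsTest.smul {D F : Type*} [NormedAddCommGroup D] [NormedSpace ℝ D] [NormedAddCommGroup F]
    [NormedSpace ℝ F] {Ω : Set D} {η : D → F} (c : ℝ) (h : IsTest Ω η) :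
    IsTest Ω (c • η) := by
  have hs : Function.support (c • η) ⊆ Function.support η := by
    intro x hx hx0
    exact hx (by simp [hx0])
  exact ⟨h.1.const_smul c, h.2.1.mono hs, (closure_mono hs).trans h.2.2⟩

/-- The pairs `(θ, ∇θ)` with `θ ∈ C_c^∞(Ω; ℝ²)`. -/
def testPairs (Ω : Set E) : Submodule ℝ (Pair Ω) where
  carrier := {p | ∃ θ : E → E, IsTest Ω θ ∧ p.fst =ᵐ[volume.restrict Ω] θ ∧
    p.snd =ᵐ[volume.restrict Ω] grad θ}
  zero_mem' := by
    refine ⟨0, ⟨contDiff_const, HasCompactSupport.zero, by simp [tsupport]⟩, ?_, ?_⟩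
    · exact Lp.coeFn_zero _ _ _
    · filter_upwards [Lp.coeFn_zero Mat 2 (volume.restrict Ω)] with x hx
      rw [show ((0 : Pair Ω).snd) = 0 from rfl, hx]
      ext p
      simp [grad, pd]
  add_mem' := by
    rintro p q ⟨θ, hθ, h1, h2⟩ ⟨η, hη, k1, k2⟩
    refine ⟨θ + η, hθ.add hη, ?_, ?_⟩
    · filter_upwards [Lp.coeFn_add p.fst q.fst, h1, k1] with x hx a b
      rw [show (p + q).fst = p.fst + q.fst from rfl, hx]
      simp [a, b]
    · filter_upwards [Lp.coeFn_add p.snd q.snd, h2, k2] with x hx a b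
      have dθ : DifferentiableAt ℝ θ x := (hθ.1.differentiable (by simp)).differentiableAt
      have dη : DifferentiableAt ℝ η x := (hη.1.differentiable (by simp)).differentiableAt
      rw [show (p + q).snd = p.snd + q.snd from rfl, hx, Pi.add_apply, a, b]
      ext i
      simp [grad, pd, fderiv_add dθ dη]
  smul_mem' := by
    rintro c p ⟨θ, hθ, h1, h2⟩
    refine ⟨c • θ, hθ.smul c, ?_, ?_⟩
    · filter_upwards [Lp.coeFn_smul c p.fst, h1] with x hx a
      rw [show (c • p).fst = c • p.fst from rfl, hx]
      simp [a]
    · filter_upwards [Lp.coeFn_smul c p.snd, h2] with x hx a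
      have dθ : DifferentiableAt ℝ θ x := (hθ.1.differentiable (by simp)).differentiableAt
      rw [show (c • p).snd = c • p.snd from rfl, hx, Pi.smul_apply, a]
      ext i
      simp [grad, pd, fderiv_const_smul dθ]

/-- `H¹₀(Ω; ℝ²)`, the closure of `C_c^∞(Ω; ℝ²)` in the `H¹` norm. A field `v` is stored together
with its weak gradient, as the pair `(v, ∇v)`. -/
def H10 (Ω : Set E) : Submodule ℝ (Pair Ω) := (testPairs Ω).topologicalClosure

/-- The space of the fields in `H¹₀(Ω; ℝ²)` whose divergence `∑ i, ∂_i v_i` vanishes. It carries the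
`H¹` norm; under a Poincaré inequality this norm is equivalent to `v ↦ ‖∇v‖`, so that the dual space
and the spaces `L²(0,T;V)`, `L²(0,T;V*)` are the same for both norms. -/
def V (Ω : Set E) : Submodule ℝ (Pair Ω) where
  carrier := {p | p ∈ H10 Ω ∧ ∀ᵐ x ∂(volume.restrict Ω), ∑ i, p.snd x (i, i) = 0}
  zero_mem' := by
    refine ⟨zero_mem _, ?_⟩
    filter_upwards [Lp.coeFn_zero Mat 2 (volume.restrict Ω)] with x hx
    rw [show ((0 : Pair Ω).snd) = 0 from rfl, hx]
    simp
  add_mem' := by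
    rintro p q ⟨hp, h⟩ ⟨hq, k⟩
    refine ⟨add_mem hp hq, ?_⟩
    filter_upwards [Lp.coeFn_add p.snd q.snd, h, k] with x hx a b
    rw [show (p + q).snd = p.snd + q.snd from rfl, hx]
    simp only [Pi.add_apply, PiLp.add_apply, Finset.sum_add_distrib, a, b, add_zero]
  smul_mem' := by
    rintro c p ⟨hp, h⟩
    refine ⟨Submodule.smul_mem _ c hp, ?_⟩
    filter_upwards [Lp.coeFn_smul c p.snd, h] with x hx a
    rw [show (c • p).snd = c • p.snd from rfl, hx]
    simp only [Pi.smul_apply, PiLp.smul_apply, ← Finset.smul_sum, a, smul_zero]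

/-- The field underlying an element of `V`. -/
def fld {Ω : Set E} (v : V Ω) : L2 Ω := (v : Pair Ω).fst

/-- The gradient of an element of `V`. -/
def dfld {Ω : Set E} (v : V Ω) : L2Mat Ω := (v : Pair Ω).snd

/-- `c` is a Poincaré constant: `‖v‖_{L²} ≤ c ‖∇v‖_{L²}` on `H¹₀(Ω; ℝ²)`. -/
def IsPoincareConst (Ω : Set E) (c : ℝ) : Prop :=
  0 < c ∧ ∀ p ∈ H10 Ω, ‖p.fst‖ ≤ c * ‖p.snd‖

/-- `c` is a Ladyzhenskaya constant: `‖v‖_{L⁴} ≤ √c ‖v‖_{L²}^{1/2} ‖∇v‖_{L²}^{1/2}` on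
`H¹₀(Ω; ℝ²)`. -/
def IsLadyzhenskayaConst (Ω : Set E) (c : ℝ) : Prop :=
  0 < c ∧ ∀ p ∈ H10 Ω, eLpNorm p.fst 4 (volume.restrict Ω) ≤
    ENNReal.ofReal (√c * √‖p.fst‖ * √‖p.snd‖)

/-- The assumptions on the porosity function. -/
structure IsPorosity (α : ℝ → ℝ) : Prop where
  nonneg : ∀ s, 0 ≤ α s
  lipschitz : ∃ K, LipschitzWith K α
  one : α 1 = 0
  neg_one : 0 < α (-1)

/-- `a_φ(v,w) = μ ∫ ∇v : ∇w + ∫ α(φ) v · w`. -/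
def aForm (Ω : Set E) (μ : ℝ) (α : ℝ → ℝ) (φ : E → ℝ) (v w : V Ω) : ℝ :=
  μ * (∫ x in Ω, ∑ i, ∑ j, dfld v x (i, j) * dfld w x (i, j)) +
    ∫ x in Ω, α (φ x) * ∑ i, fld v x i * fld w x i

/-- `b(u,v,w) = ∫ [(u · ∇) v] · w = ∫ ∑ i j, u_j ∂_j v_i w_i`, where `G` stands for `∇v`. -/
def bForm (Ω : Set E) (u : E → E) (G : E → Mat) (w : E → E) : ℝ :=
  ∫ x in Ω, ∑ i, ∑ j, u x j * G x (i, j) * w x i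

/-- The `L²` inner product `(v,w)_Ω`. -/
def ip (Ω : Set E) (v w : E → E) : ℝ := ∫ x in Ω, ∑ i, v x i * w x i

/-- `u'` is the weak derivative of `u` on `(0,T)` as a function with values in `V*`, where `v ∈ V`
is identified with the functional `(v, ·)_Ω`. -/
def IsWeakTimeDeriv (Ω : Set E) (T : ℝ) (u : ℝ → V Ω) (u' : ℝ → (V Ω →L[ℝ] ℝ)) : Prop :=
  ∀ (ψ : V Ω) (η : ℝ → ℝ), IsTest (Ioo 0 T) η →
    ∫ t in Ioo 0 T, ip Ω (fld (u t)) (fld ψ) * deriv η t = - ∫ t in Ioo 0 T, u' t ψ * η t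

/-- `u ∈ L²(0,T;V)` with `∂_t u ∈ L²(0,T;V*)` is a weak solution, with initial value `u₀`, of
`∂_t u + α(φ) u - μ Δu + (u · ∇) u₁ + (u₂ · ∇) u + ∇p = F`, `div u = 0`, `u = 0` on `∂Ω`.
Here `G₁` stands for `∇u₁`. The initial condition says that `u(t) → u₀` in `L²` as `t → 0⁺` outside
a null set of times, i.e. that the representative of `u` that is continuous with values in `L²`
takes the value `u₀` at `0`. -/
def IsWeakSolution (Ω : Set E) (T μ : ℝ) (α : ℝ → ℝ) (φ : E → ℝ) (G₁ : ℝ → L2Mat Ω)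
    (u₂ : ℝ → L4 Ω) (F : ℝ → L2 Ω) (u₀ : L2 Ω) (u : ℝ → V Ω) : Prop :=
  MemLp u 2 (timeMeas T) ∧
  (∃ u' : ℝ → (V Ω →L[ℝ] ℝ), MemLp u' 2 (timeMeas T) ∧ IsWeakTimeDeriv Ω T u u' ∧
    ∀ᵐ t ∂(timeMeas T), ∀ ψ : V Ω,
      u' t ψ + aForm Ω μ α φ (u t) ψ + bForm Ω (fld (u t)) (G₁ t) (fld ψ)
        + bForm Ω (u₂ t) (dfld (u t)) (fld ψ) = ip Ω (F t) (fld ψ)) ∧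
  Tendsto (fun t => fld (u t)) (𝓝[>] 0 ⊓ ae volume) (𝓝 u₀)

/-- `A(t) = (2 c_L² / μ) ∫_0^t ‖z(τ)‖² dτ - (μ / c_P²) t`. -/
def expA {Ω : Set E} (μ cP cL : ℝ) (z : ℝ → L2 Ω) (t : ℝ) : ℝ :=
  2 * cL ^ 2 / μ * (∫ τ in (0 : ℝ)..t, ‖z τ‖ ^ 2) - μ / cP ^ 2 * t

end LinNS

end

/-! The estimate is the energy estimate obtained by testing the equation with the solution itself.
The term `b(u₂, v, v)` vanishes because `u₂` is divergence free, and the porosity term is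
nonnegative. Hölder and Ladyzhenskaya bound `b(v, u₁, v)` by `cL ‖v‖ ‖∇v‖ ‖z‖`, and Poincaré bounds
the force term by `cP ‖F‖ ‖∇v‖`. Young's inequality moves both gradients into half of the
dissipation `2 μ ‖∇v‖²`; the other half becomes the decay rate `μ / cP²` by Poincaré
(`energy_inequality`). Gronwall's inequality for absolutely continuous functions finishes
(`gronwall_of_integral`).

The delicate point is that `‖v‖²` has derivative `2 ⟨∂ₜv, v⟩` although `∂ₜv` only takes values in
the dual of `V`. Let `ι : V → L²` be the embedding, `J = ι* ι`, and `g` the Riesz representative of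
`∂ₜv`. The weak formulation says that `J v` has weak derivative `g` in `V`, so `J v = c + ∫ g =: W`
almost everywhere. The resolvents `R n = (J + ε)⁻¹`, `ε → 0`, regularize: `R n W` is absolutely
continuous in `V` and obeys the energy identity by the ordinary chain rule, while `R n J → 1`
strongly. The same identity for differences shows that `ι R n W` is uniformly Cauchy in `L²`; its
limit is the continuous representative (`exists_continuous_representative`). This uses that `ι` is
injective and `V` complete, but not that `V` is dense in `H`. -/

noncomputable section

namespace LinNS

/-! ### Absolutely continuous functions and the chain rule for quadratic forms -/

section AbsolutelyContinuous

/-- A function whose increments are dominated by those of an absolutely continuous function is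
absolutely continuous. -/
lemma absolutelyContinuousOnInterval_of_dist_le {X Y : Type*} [PseudoMetricSpace X]
    [PseudoMetricSpace Y] {f : ℝ → X} {k : ℝ → Y} {a b C : ℝ}
    (hk : AbsolutelyContinuousOnInterval k a b)
    (h : ∀ s ∈ uIcc a b, ∀ t ∈ uIcc a b, dist (f s) (f t) ≤ C * dist (k s) (k t)) :
    AbsolutelyContinuousOnInterval f a b := by
  have hk' := Filter.Tendsto.const_mul C hk
  rw [mul_zero] at hk'
  refine squeeze_zero' (Eventually.of_forall fun t => Finset.sum_nonneg fun i _ => dist_nonneg)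
    ?_ hk'
  filter_upwards [inter_mem_inf univ_mem (mem_principal_self _)] with I hI
  rw [Finset.mul_sum]
  exact Finset.sum_le_sum fun i hi => h _ (hI.2.1 i hi).1 _ (hI.2.1 i hi).2

/-- The fundamental theorem of calculus for an absolutely continuous function whose derivative is
known almost everywhere. -/
lemma integral_eq_sub_of_absolutelyContinuous {f f' : ℝ → ℝ} {a b : ℝ}
    (hf : AbsolutelyContinuousOnInterval f a b)
    (hd : ∀ᵐ x, x ∈ uIcc a b → HasDerivAt f (f' x) x) :
    ∫ x in a..b, f' x = f b - f a := by
  rw [← hf.integral_deriv_eq_sub]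
  refine intervalIntegral.integral_congr_ae ?_
  filter_upwards [hd] with x hx h
  exact (hx (uIoc_subset_uIcc h)).deriv.symm

/-- Chain rule for a quadratic form along the primitive of an integrable function. -/
lemma quadratic_form_primitive {X : Type*} [NormedAddCommGroup X] [InnerProductSpace ℝ X]
    [CompleteSpace X] (S : X →L[ℝ] X) (hS : ∀ x y, inner ℝ (S x) y = inner ℝ x (S y))
    {g : ℝ → X} (c : X) {t : ℝ} (hg : IntervalIntegrable g volume 0 t) :
    inner ℝ (S (c + ∫ r in (0 : ℝ)..t, g r)) (c + ∫ r in (0 : ℝ)..t, g r) - inner ℝ (S c) c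
      = 2 * ∫ r in (0 : ℝ)..t, inner ℝ (S (c + ∫ s in (0 : ℝ)..r, g s)) (g r) := by
  set w : ℝ → X := fun r => c + ∫ s in (0 : ℝ)..r, g s with hw
  have hgn : IntervalIntegrable (fun r => ‖g r‖) volume 0 t := hg.norm
  have hsub : ∀ s ∈ uIcc 0 t, IntervalIntegrable g volume 0 s := fun s hs =>
    hg.mono_set (uIcc_subset_uIcc left_mem_uIcc hs)
  -- The increments of the vector-valued primitive are controlled by those of the scalar function `∫
  -- ‖g‖`, which is absolutely continuous.
  have hdist : ∀ s ∈ uIcc 0 t, ∀ r ∈ uIcc 0 t,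
      ‖w s - w r‖ ≤ |(∫ x in (0 : ℝ)..s, ‖g x‖) - ∫ x in (0 : ℝ)..r, ‖g x‖| := by
    intro s hs r hr
    have e1 : w s - w r = ∫ x in r..s, g x := by
      simp only [hw, add_sub_add_left_eq_sub]
      exact intervalIntegral.integral_interval_sub_left (hsub s hs) (hsub r hr)
    rw [e1, intervalIntegral.integral_interval_sub_left (hsub s hs).norm (hsub r hr).norm]
    exact intervalIntegral.norm_integral_le_abs_integral_norm
  have hK : AbsolutelyContinuousOnInterval (fun s => ∫ x in (0 : ℝ)..s, ‖g x‖) 0 t :=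
    hgn.absolutelyContinuousOnInterval_intervalIntegral left_mem_uIcc
  have hwac : AbsolutelyContinuousOnInterval w 0 t :=
    absolutelyContinuousOnInterval_of_dist_le (C := 1) hK fun s hs r hr => by
      rw [one_mul, dist_eq_norm, Real.dist_eq]; exact hdist s hs r hr
  obtain ⟨M, hM⟩ := hwac.exists_bound
  have hM0 : 0 ≤ M := (norm_nonneg _).trans (hM 0 left_mem_uIcc)
  have hq : AbsolutelyContinuousOnInterval (fun s => inner ℝ (S (w s)) (w s)) 0 t := by
    refine absolutelyContinuousOnInterval_of_dist_le (C := ‖S‖ * M + ‖S‖ * M) hwac ?_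
    intro s hs r hr
    rw [Real.dist_eq, dist_eq_norm]
    have e : inner ℝ (S (w s)) (w s) - inner ℝ (S (w r)) (w r)
        = inner ℝ (S (w s)) (w s - w r) + inner ℝ (S (w s - w r)) (w r) := by
      rw [map_sub, inner_sub_left, inner_sub_right]; ring
    rw [e]
    refine (abs_add_le _ _).trans ?_
    have h1 := abs_real_inner_le_norm (S (w s)) (w s - w r)
    have h2 := abs_real_inner_le_norm (S (w s - w r)) (w r)
    have h3 : ‖S (w s)‖ ≤ ‖S‖ * M := (S.le_opNorm _).trans (by gcongr; exact hM s hs)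
    have h4 : ‖S (w s - w r)‖ * ‖w r‖ ≤ ‖S‖ * ‖w s - w r‖ * M := by
      gcongr
      · exact S.le_opNorm _
      · exact hM r hr
    have h5 : ‖S (w s)‖ * ‖w s - w r‖ ≤ ‖S‖ * M * ‖w s - w r‖ := by gcongr
    linarith
  have hder : ∀ᵐ x, x ∈ uIcc 0 t →
      HasDerivAt (fun s => inner ℝ (S (w s)) (w s)) (2 * inner ℝ (S (w x)) (g x)) x := by
    filter_upwards [hg.ae_hasDerivAt_integral] with x hx hxt
    have h1 : HasDerivAt w (g x) x := (hx hxt 0 left_mem_uIcc).const_add c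
    have h2 : HasDerivAt (fun s => S (w s)) (S (g x)) x := S.hasFDerivAt.comp_hasDerivAt x h1
    convert! h2.inner ℝ h1 using 1
    rw [hS (g x), real_inner_comm]; ring
  have := integral_eq_sub_of_absolutelyContinuous hq hder
  rw [intervalIntegral.integral_const_mul] at this
  rw [this]
  simp [hw]

end AbsolutelyContinuous

/-! ### Regularization by resolvents -/

section Resolvent

variable {X H : Type*} [NormedAddCommGroup X] [InnerProductSpace ℝ X] [CompleteSpace X]
  [NormedAddCommGroup H] [InnerProductSpace ℝ H]

/-- The operators `(J + ε)⁻¹`, `J = ι* ι`, along a sequence `ε → 0`: they are symmetric, commute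
with `J`, and `(J + ε)⁻¹ J` tends strongly to the identity when `ι` is injective. -/
lemma exists_resolvent_sequence (ι : X →L[ℝ] H) (hι : Function.Injective ι) (J : X →L[ℝ] X)
    (hJ : ∀ x y, inner ℝ (J x) y = inner ℝ (ι x) (ι y)) :
    ∃ R : ℕ → X →L[ℝ] X, (∀ n x y, inner ℝ (R n x) y = inner ℝ x (R n y)) ∧
      (∀ n x, R n (J x) = J (R n x)) ∧ (∀ n x, ‖R n (J x)‖ ≤ 2 * ‖x‖) ∧
      ∀ x, Tendsto (fun n => R n (J x)) atTop (𝓝 x) := by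
  have hJs : ∀ x y, inner ℝ (J x) y = inner ℝ x (J y) := fun x y => by
    rw [hJ, ← real_inner_comm, ← hJ, real_inner_comm]
  have hJp : ∀ x, 0 ≤ inner ℝ (J x) x := fun x => by rw [hJ]; exact real_inner_self_nonneg
  -- `J ≥ 0` makes `J + ε` coercive, so Lax–Milgram inverts it.
  have key : ∀ ε : ℝ, 0 < ε → ∃ e : X ≃L[ℝ] X, ∀ x, e x = ε • x + J x := by
    intro ε hε
    have hco : IsCoercive ((innerSL ℝ).comp (ε • ContinuousLinearMap.id ℝ X + J)) := by
      refine ⟨ε, hε, fun x => ?_⟩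
      have : ((innerSL ℝ).comp (ε • ContinuousLinearMap.id ℝ X + J)) x x
          = ε * (‖x‖ * ‖x‖) + inner ℝ (J x) x := by
        change inner ℝ (ε • x + J x) x = _
        rw [inner_add_left, real_inner_smul_left, real_inner_self_eq_norm_mul_norm]
      rw [this]
      nlinarith [hJp x]
    refine ⟨hco.continuousLinearEquivOfBilin, fun x => ?_⟩
    refine (hco.unique_continuousLinearEquivOfBilin fun w => ?_).symm
    rfl
  choose! e he using key
  set ε : ℕ → ℝ := fun n => 1 / ((n : ℝ) + 1) with hεdef
  have hε : ∀ n, 0 < ε n := fun n => Nat.one_div_pos_of_nat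
  have he' : ∀ n x, e (ε n) x = ε n • x + J x := fun n x => he _ (hε n) x
  have hsolve : ∀ n x, ε n • (e (ε n)).symm x + J ((e (ε n)).symm x) = x := fun n x => by
    rw [← he', ContinuousLinearEquiv.apply_symm_apply]
  have hcomm : ∀ n x, (e (ε n)).symm (J x) = J ((e (ε n)).symm x) := by
    intro n x
    rw [ContinuousLinearEquiv.symm_apply_eq, he', ← map_smul, ← map_add, hsolve]
  have hbd : ∀ n x, ‖ε n • (e (ε n)).symm x‖ ≤ ‖x‖ := by
    intro n x
    set y := (e (ε n)).symm x
    have h1 : inner ℝ x y = ε n * (‖y‖ * ‖y‖) + inner ℝ (J y) y := by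
      conv_lhs => rw [← hsolve n x]
      rw [inner_add_left, inner_smul_left, real_inner_self_eq_norm_mul_norm]; rfl
    have h2 := real_inner_le_norm x y
    rw [norm_smul, Real.norm_of_nonneg (hε n).le]
    rcases (norm_nonneg y).eq_or_lt with h0 | h0
    · rw [← h0]; simp
    · have := hJp y
      refine le_of_mul_le_mul_right ?_ h0
      nlinarith
  -- Since `(J + ε)⁻¹ J = 1 - ε (J + ε)⁻¹`, it remains to show that `ε (J + ε)⁻¹ → 0` strongly.
  have hdiff : ∀ n x, (e (ε n)).symm (J x) = x - ε n • (e (ε n)).symm x := fun n x => by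
    rw [hcomm]; exact eq_sub_of_add_eq' (hsolve n x)
  have hnorm : ∀ n x, ‖(e (ε n)).symm (J x)‖ ≤ 2 * ‖x‖ := fun n x => by
    rw [hdiff]
    linarith [norm_sub_le x (ε n • (e (ε n)).symm x), hbd n x]
  have hε0 : Tendsto ε atTop (𝓝 0) := tendsto_one_div_add_atTop_nhds_zero_nat
  -- A vector `x` orthogonal to the range of `J` has `‖ι x‖² = (J x, x) = 0`.
  have hdense : Dense (LinearMap.range (J : X →ₗ[ℝ] X) : Set X) := by
    rw [Submodule.dense_iff_topologicalClosure_eq_top, Submodule.topologicalClosure_eq_top_iff,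
      Submodule.eq_bot_iff]
    intro x hx
    have h1 : inner ℝ (J x) x = 0 := hx _ ⟨x, rfl⟩
    rw [hJ, inner_self_eq_zero] at h1
    exact hι (h1.trans (map_zero ι).symm)
  refine ⟨fun n => ((e (ε n)).symm : X →L[ℝ] X), ?_, hcomm, hnorm, ?_⟩
  · intro n x y
    change inner ℝ ((e (ε n)).symm x) y = inner ℝ x ((e (ε n)).symm y)
    conv_lhs => rw [← hsolve n y]
    conv_rhs => rw [← hsolve n x]
    rw [inner_add_left, inner_add_right, inner_smul_left, inner_smul_right, hJs]; rfl
  · intro x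
    -- On the range of `J` the norm is at most `2 ε ‖y‖`; density and the uniform bound `hbd` extend
    -- the convergence to every `x`.
    have h0 : Tendsto (fun n => ε n • (e (ε n)).symm x) atTop (𝓝 0) := by
      rw [Metric.tendsto_atTop]
      intro δ hδ
      obtain ⟨_, hy, y, rfl⟩ := Metric.dense_iff.1 hdense x (δ / 2) (by positivity)
      rw [Metric.mem_ball, dist_comm, dist_eq_norm] at hy
      have h1 : Tendsto (fun n => ε n * (2 * ‖y‖)) atTop (𝓝 0) := by
        simpa using hε0.mul_const (2 * ‖y‖)
      obtain ⟨N, hN⟩ := (h1.eventually (gt_mem_nhds (half_pos hδ))).exists_forall_of_atTop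
      refine ⟨N, fun n hn => ?_⟩
      have e1 : ε n • (e (ε n)).symm x
          = ε n • (e (ε n)).symm (x - J y) + ε n • (e (ε n)).symm (J y) := by
        rw [← smul_add, ← map_add, sub_add_cancel]
      have h2 : ‖ε n • (e (ε n)).symm (J y)‖ ≤ ε n * (2 * ‖y‖) := by
        rw [norm_smul, Real.norm_of_nonneg (hε n).le]
        exact mul_le_mul_of_nonneg_left (hnorm n y) (hε n).le
      rw [dist_zero_right, e1]
      refine (norm_add_le _ _).trans_lt ?_
      have h3 := hbd n (x - J y)
      have h4 := hN n hn
      have h5 : ‖x - J y‖ < δ / 2 := hy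
      linarith
    have : (fun n => ((e (ε n)).symm : X →L[ℝ] X) (J x))
        = fun n => x - ε n • (e (ε n)).symm x := funext fun n => hdiff n x
    rw [this]
    simpa using h0.const_sub x

end Resolvent

/-! ### Functions of time with a weak derivative -/

section DuBoisReymond

/-- The primitive of a test function with vanishing integral is a test function. -/
lemma exists_isTest_primitive {T : ℝ} {η : ℝ → ℝ} (hη : IsTest (Ioo 0 T) η)
    (h0 : ∫ t, η t = 0) : ∃ ζ : ℝ → ℝ, IsTest (Ioo 0 T) ζ ∧ deriv ζ = η := by
  rcases (tsupport η).eq_empty_or_nonempty with he | hne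
  · refine ⟨0, ⟨contDiff_const, HasCompactSupport.zero, by simp [tsupport]⟩, ?_⟩
    rw [tsupport_eq_empty_iff.1 he]
    ext; simp
  -- The primitive taken from the left end `a` of the support vanishes before `a`, and after the
  -- right end `b` because the total integral is zero.
  obtain ⟨a, ha⟩ := hη.2.1.isCompact.exists_isLeast hne
  obtain ⟨b, hb⟩ := hη.2.1.isCompact.exists_isGreatest hne
  have hη0 : ∀ t, t ∉ Icc a b → η t = 0 := fun t ht =>
    image_eq_zero_of_notMem_tsupport fun h => ht ⟨ha.2 h, hb.2 h⟩
  have hc : Continuous η := hη.1.continuous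
  have hd : ∀ x, HasDerivAt (fun t => ∫ s in a..t, η s) (η x) x := fun x =>
    hc.integral_hasStrictDerivAt a x |>.hasDerivAt
  have hderiv : deriv (fun t => ∫ s in a..t, η s) = η := funext fun x => (hd x).deriv
  have hlow : ∀ t, t ≤ a → ∫ s in a..t, η s = 0 := by
    intro t ht
    rw [intervalIntegral.integral_symm, intervalIntegral.integral_of_le ht,
      integral_Ioc_eq_integral_Ioo, setIntegral_eq_zero_of_forall_eq_zero, neg_zero]
    exact fun s hs => hη0 s fun h => absurd h.1 (not_le.2 hs.2)
  have hhigh : ∀ t, b ≤ t → ∫ s in a..t, η s = 0 := by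
    intro t ht
    rw [intervalIntegral.integral_of_le ((ha.2 hb.1).trans ht), ← integral_Icc_eq_integral_Ioc,
      setIntegral_eq_integral_of_forall_compl_eq_zero, h0]
    exact fun s hs => hη0 s fun h => hs ⟨h.1, h.2.trans ht⟩
  have hsupp : tsupport (fun t => ∫ s in a..t, η s) ⊆ Icc a b := by
    refine closure_minimal (fun t ht => ?_) isClosed_Icc
    by_contra hcon
    rcases not_and_or.1 hcon with h | h
    · exact ht (hlow t (not_le.1 h).le)
    · exact ht (hhigh t (not_le.1 h).le)
  refine ⟨_, ⟨?_, isCompact_Icc.of_isClosed_subset (isClosed_tsupport _) hsupp, hsupp.trans ?_⟩,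
    hderiv⟩
  · rw [contDiff_infty_iff_deriv, hderiv]
    exact ⟨fun x => (hd x).differentiableAt, hη.1⟩
  · exact fun t ht => ⟨(hη.2.2 ha.1).1.trans_le ht.1, ht.2.trans_lt (hη.2.2 hb.1).2⟩

/-- There is a test function on `(0,T)` with integral one. -/
lemma exists_isTest_integral_eq_one {T : ℝ} (hT : 0 < T) :
    ∃ η : ℝ → ℝ, IsTest (Ioo 0 T) η ∧ ∫ t, η t = 1 := by
  let f : ContDiffBump (T / 2 : ℝ) := ⟨T / 8, T / 4, by positivity, by linarith⟩
  refine ⟨f.normed volume, ⟨f.contDiff_normed, f.hasCompactSupport_normed, ?_⟩,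
    f.integral_normed⟩
  rw [f.tsupport_normed_eq, Real.closedBall_eq_Icc]
  intro t ht
  have h : f.rOut = T / 4 := rfl
  rw [h] at ht
  exact ⟨by linarith [ht.1], by linarith [ht.2]⟩

/-- A function on `(0,T)` with vanishing weak derivative is constant. -/
lemma ae_const_of_integral_deriv_smul_eq_zero {X : Type*} [NormedAddCommGroup X]
    [NormedSpace ℝ X] [CompleteSpace X] {T : ℝ} (hT : 0 < T) {k : ℝ → X}
    (hk : IntegrableOn k (Ioo 0 T))
    (h : ∀ η : ℝ → ℝ, IsTest (Ioo 0 T) η → ∫ t in Ioo 0 T, deriv η t • k t = 0) :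
    ∃ c, ∀ᵐ t ∂(timeMeas T), k t = c := by
  obtain ⟨η₀, hη₀, hη₀1⟩ := exists_isTest_integral_eq_one hT
  have hint : ∀ η : ℝ → ℝ, IsTest (Ioo 0 T) η →
      Integrable (fun t => η t • k t) (volume.restrict (Ioo 0 T)) := by
    intro η hη
    obtain ⟨C, hC⟩ := hη.1.continuous.bounded_above_of_compact_support hη.2.1
    exact hk.bdd_smul C hη.1.continuous.aestronglyMeasurable (Eventually.of_forall hC)
  have hintη : ∀ η : ℝ → ℝ, IsTest (Ioo 0 T) η → Integrable η := fun η hη =>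
    hη.1.continuous.integrable_of_hasCompactSupport hη.2.1
  have hset : ∀ η : ℝ → ℝ, IsTest (Ioo 0 T) η → ∫ t in Ioo 0 T, η t = ∫ t, η t := fun η hη =>
    setIntegral_eq_integral_of_forall_compl_eq_zero fun t ht =>
      image_eq_zero_of_notMem_tsupport fun h => ht (hη.2.2 h)
  set c : X := ∫ t in Ioo 0 T, η₀ t • k t with hc
  refine ⟨c, ?_⟩
  have hkc : IntegrableOn (fun t => k t - c) (Ioo 0 T) := hk.sub (integrable_const c)
  have := isOpen_Ioo.ae_eq_zero_of_integral_contDiff_smul_eq_zero (μ := volume)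
    hkc.locallyIntegrableOn ?_
  · rw [ae_restrict_iff' measurableSet_Ioo]
    filter_upwards [this] with t ht h
    exact sub_eq_zero.1 (ht h)
  intro η hη1 hη2 hη3
  have hη : IsTest (Ioo 0 T) η := ⟨hη1, hη2, hη3⟩
  -- Subtracting `(∫ η) η₀` gives integral zero, so this is the derivative of a test function; the
  -- hypothesis then yields `∫ η k = (∫ η) c`.
  have hcomb : IsTest (Ioo 0 T) (η + (-∫ t, η t) • η₀) := hη.add (hη₀.smul _)
  obtain ⟨ζ, hζ, hζ'⟩ := exists_isTest_primitive hcomb (by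
    simp only [Pi.add_apply, Pi.smul_apply, smul_eq_mul]
    rw [integral_add (hintη η hη) ((hintη η₀ hη₀).const_mul _), integral_const_mul, hη₀1]
    ring)
  have h1 := h ζ hζ
  rw [hζ'] at h1
  simp only [Pi.add_apply, Pi.smul_apply, smul_eq_mul, add_smul, mul_smul] at h1
  have hi₀ : Integrable (fun t => (-∫ t, η t) • η₀ t • k t) (volume.restrict (Ioo 0 T)) :=
    (hint η₀ hη₀).smul _
  rw [integral_add (hint η hη) hi₀, integral_smul, ← hc] at h1
  have h2 : ∫ t, η t • (k t - c) = ∫ t in Ioo 0 T, η t • (k t - c) :=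
    (setIntegral_eq_integral_of_forall_compl_eq_zero fun t ht => by
      rw [image_eq_zero_of_notMem_tsupport fun h => ht (hη3 h), zero_smul]).symm
  rw [h2]
  simp only [smul_sub]
  rw [integral_sub (hint η hη) ((hintη η hη).integrableOn.smul_const c), integral_smul_const,
    hset η hη, ← h1, neg_smul]
  abel

/-- A function on `(0,T)` with integrable weak derivative `g` is a primitive of `g`. -/
lemma exists_primitive_of_weak_deriv {X : Type*} [NormedAddCommGroup X]
    [InnerProductSpace ℝ X] [CompleteSpace X] {T : ℝ} (hT : 0 < T) {f g : ℝ → X}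
    (hf : IntegrableOn f (Ioo 0 T)) (hg : IntegrableOn g (Ioo 0 T))
    (h : ∀ (ψ : X) (η : ℝ → ℝ), IsTest (Ioo 0 T) η →
      ∫ t in Ioo 0 T, inner ℝ (f t) ψ * deriv η t = - ∫ t in Ioo 0 T, inner ℝ (g t) ψ * η t) :
    ∃ c, ∀ᵐ t ∂(timeMeas T), f t = c + ∫ r in (0 : ℝ)..t, g r := by
  have hgI : IntervalIntegrable g volume 0 T :=
    (intervalIntegrable_iff_integrableOn_Ioo_of_le hT.le).2 hg
  have hcont : ContinuousOn (fun t => ∫ r in (0 : ℝ)..t, g r) (uIcc 0 T) :=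
    intervalIntegral.continuousOn_primitive_interval' hgI left_mem_uIcc
  have hW : IntegrableOn (fun t => ∫ r in (0 : ℝ)..t, g r) (Ioo 0 T) := by
    rw [uIcc_of_le hT.le] at hcont
    exact (hcont.integrableOn_compact isCompact_Icc).mono_set Ioo_subset_Icc_self
  have hderivTest : ∀ η : ℝ → ℝ, IsTest (Ioo 0 T) η → ∃ C, ∀ t, ‖deriv η t‖ ≤ C := fun η hη =>
    (hη.1.continuous_deriv (by simp)).bounded_above_of_compact_support hη.2.1.deriv
  obtain ⟨c, hc⟩ := ae_const_of_integral_deriv_smul_eq_zero hT (hf.sub hW) (fun η hη => by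
    obtain ⟨C, hC⟩ := hderivTest η hη
    have hdm : AEStronglyMeasurable (deriv η) (volume.restrict (Ioo 0 T)) :=
      (hη.1.continuous_deriv (by simp)).aestronglyMeasurable
    have hif : Integrable (fun t => deriv η t • f t) (volume.restrict (Ioo 0 T)) :=
      hf.bdd_smul C hdm (Eventually.of_forall hC)
    have hiW : Integrable (fun t => deriv η t • ∫ r in (0 : ℝ)..t, g r)
        (volume.restrict (Ioo 0 T)) :=
      hW.bdd_smul C hdm (Eventually.of_forall hC)
    simp only [Pi.sub_apply, smul_sub]
    rw [integral_sub hif hiW, sub_eq_zero]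
    refine ext_inner_right ℝ fun ψ => ?_
    rw [real_inner_comm, real_inner_comm ψ, ← integral_inner hif, ← integral_inner hiW]
    have e1 : ∫ t in Ioo 0 T, inner ℝ ψ (deriv η t • f t)
        = ∫ t in Ioo 0 T, inner ℝ (f t) ψ * deriv η t := by
      congr 1 with t
      rw [real_inner_smul_right, real_inner_comm, mul_comm]
    rw [e1, h ψ η hη]
    have hgψ : IntervalIntegrable (fun t => inner ℝ ψ (g t)) volume 0 T :=
      (intervalIntegrable_iff_integrableOn_Ioo_of_le hT.le).2 (hg.const_inner ψ)
    have hac : AbsolutelyContinuousOnInterval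
        (fun t => ∫ r in (0 : ℝ)..t, inner ℝ ψ (g r)) 0 T :=
      hgψ.absolutelyContinuousOnInterval_intervalIntegral left_mem_uIcc
    have hηac : AbsolutelyContinuousOnInterval η 0 T :=
      (hη.1.of_le (by simp)).contDiffOn.absolutelyContinuousOnInterval
    have hη0 : η 0 = 0 := image_eq_zero_of_notMem_tsupport fun h => lt_irrefl _ (hη.2.2 h).1
    have hηT : η T = 0 := image_eq_zero_of_notMem_tsupport fun h => lt_irrefl _ (hη.2.2 h).2
    -- Paired with `ψ`, the claim is scalar integration by parts; the boundary terms vanish as `η`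
    -- is zero at `0` and `T`.
    have hparts := hac.integral_mul_deriv_eq_deriv_mul hηac
    rw [hη0, hηT, mul_zero, mul_zero, sub_zero, zero_sub] at hparts
    have e2 : ∫ t in (0 : ℝ)..T, deriv (fun t => ∫ r in (0 : ℝ)..t, inner ℝ ψ (g r)) t * η t
        = ∫ t in Ioo 0 T, inner ℝ (g t) ψ * η t := by
      rw [intervalIntegral.integral_congr_ae (g := fun t => inner ℝ (g t) ψ * η t),
        intervalIntegral.integral_of_le hT.le, integral_Ioc_eq_integral_Ioo]
      filter_upwards [hgψ.ae_hasDerivAt_integral] with t ht h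
      rw [(ht (uIoc_subset_uIcc h) 0 left_mem_uIcc).deriv, real_inner_comm]
    rw [e2] at hparts
    rw [← hparts, intervalIntegral.integral_of_le hT.le, integral_Ioc_eq_integral_Ioo]
    refine setIntegral_congr_fun measurableSet_Ioo fun t ht => ?_
    have hgt : IntervalIntegrable g volume 0 t :=
      hgI.mono_set (uIcc_subset_uIcc left_mem_uIcc (by
        rw [uIcc_of_le hT.le]; exact Ioo_subset_Icc_self ht))
    rw [real_inner_smul_right, mul_comm, intervalIntegral.integral_of_le ht.1.le,
      intervalIntegral.integral_of_le ht.1.le, integral_inner hgt.1])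
  refine ⟨c, ?_⟩
  filter_upwards [hc] with t ht
  exact sub_eq_iff_eq_add.1 ht

end DuBoisReymond

/-! ### Continuity in time and the energy identity -/

section LionsMagenes

/-- If `D n` are operators with `‖D n x‖ ≤ C ‖x‖` and `D n x → 0` for all `x`, then
`∫ ‖D n u‖ ‖g‖ → 0`. -/
lemma tendsto_integral_norm_mul_norm {X : Type*} [NormedAddCommGroup X] [NormedSpace ℝ X] {T : ℝ} {u g : ℝ → X} (hu : MemLp u 2 (timeMeas T))
    (hg : MemLp g 2 (timeMeas T)) (D : ℕ → X →L[ℝ] X) {C : ℝ} (hC : ∀ n x, ‖D n x‖ ≤ C * ‖x‖)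
    (hD : ∀ x, Tendsto (fun n => D n x) atTop (𝓝 0)) :
    Tendsto (fun n => ∫ t in Ioo 0 T, ‖D n (u t)‖ * ‖g t‖) atTop (𝓝 0) := by
  have hbound : Integrable (fun t => C * (‖u t‖ * ‖g t‖)) (timeMeas T) :=
    (hu.norm.integrable_mul hg.norm).const_mul C
  have := tendsto_integral_of_dominated_convergence (μ := timeMeas T)
    (F := fun n t => ‖D n (u t)‖ * ‖g t‖) (f := fun _ => (0 : ℝ)) _
    (fun n => ((D n).continuous.comp_aestronglyMeasurable hu.1).norm.mul hg.1.norm) hbound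
    (fun n => Eventually.of_forall fun t => by
      rw [norm_mul, norm_norm, norm_norm, ← mul_assoc]
      exact mul_le_mul_of_nonneg_right (hC n _) (norm_nonneg _))
    (Eventually.of_forall fun t => by
      simpa using ((hD (u t)).norm.mul_const ‖g t‖))
  simpa using this

lemma intervalIntegral_congr_timeMeas {T t : ℝ} (ht : t ∈ Icc 0 T) {f g : ℝ → ℝ}
    (h : ∀ᵐ s ∂(timeMeas T), f s = g s) : ∫ s in (0 : ℝ)..t, f s = ∫ s in (0 : ℝ)..t, g s := by
  rw [intervalIntegral.integral_of_le ht.1, intervalIntegral.integral_of_le ht.1,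
    integral_Ioc_eq_integral_Ioo, integral_Ioc_eq_integral_Ioo]
  exact integral_congr_ae (ae_restrict_of_ae_restrict_of_subset (Ioo_subset_Ioo_right ht.2) h)

/-- Let `u ∈ L²(0,T;X)` be such that `t ↦ (ι u(t), ι ·)` has the weak derivative `g ∈ L²(0,T;X)`
(with `X` identified with its dual). Then `ι u` has a continuous representative, and its squared
norm is absolutely continuous with derivative `2 (g, u)`. -/
theorem exists_continuous_representative {X H : Type*} [NormedAddCommGroup X]
    [InnerProductSpace ℝ X] [CompleteSpace X] [NormedAddCommGroup H] [InnerProductSpace ℝ H]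
    [CompleteSpace H] {T : ℝ} (hT : 0 < T) (ι : X →L[ℝ] H)
    (hι : Function.Injective ι) {u g : ℝ → X} (hu : MemLp u 2 (timeMeas T))
    (hg : MemLp g 2 (timeMeas T))
    (h : ∀ (ψ : X) (η : ℝ → ℝ), IsTest (Ioo 0 T) η →
      ∫ t in Ioo 0 T, inner ℝ (ι (u t)) (ι ψ) * deriv η t
        = - ∫ t in Ioo 0 T, inner ℝ (g t) ψ * η t) :
    ∃ w : ℝ → H, ContinuousOn w (Icc 0 T) ∧ (∀ᵐ t ∂(timeMeas T), w t = ι (u t)) ∧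
      ∀ t ∈ Icc 0 T, ‖w t‖ ^ 2 = ‖w 0‖ ^ 2 + 2 * ∫ s in (0 : ℝ)..t, inner ℝ (u s) (g s) := by
  set J : X →L[ℝ] X := ι.adjoint ∘L ι with hJdef
  have hJ : ∀ x y, inner ℝ (J x) y = inner ℝ (ι x) (ι y) := fun x y => by
    rw [hJdef, ContinuousLinearMap.comp_apply, ContinuousLinearMap.adjoint_inner_left]
  have hJs : ∀ x y, inner ℝ (J x) y = inner ℝ x (J y) := fun x y => by
    rw [hJ, ← real_inner_comm, ← hJ, real_inner_comm]
  obtain ⟨R, hRs, hRJ, hRb, hRt⟩ := exists_resolvent_sequence ι hι J hJ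
  have hgi : IntegrableOn g (Ioo 0 T) := hg.integrable (by norm_num)
  have hgI : IntervalIntegrable g volume 0 T :=
    (intervalIntegrable_iff_integrableOn_Ioo_of_le hT.le).2 hgi
  obtain ⟨c, hc⟩ := exists_primitive_of_weak_deriv hT (f := fun t => J (u t)) (g := g)
    (J.integrable_comp (hu.integrable (by norm_num))) hgi (by simpa only [hJ] using h)
  set W : ℝ → X := fun t => c + ∫ r in (0 : ℝ)..t, g r with hW
  have hW0 : W 0 = c := by simp [hW]
  have hWc : ContinuousOn W (Icc 0 T) := by
    have := intervalIntegral.continuousOn_primitive_interval' hgI left_mem_uIcc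
    rw [uIcc_of_le hT.le] at this
    exact continuousOn_const.add this
  have hgt : ∀ t ∈ Icc 0 T, IntervalIntegrable g volume 0 t := fun t ht =>
    hgI.mono_set (uIcc_subset_uIcc left_mem_uIcc (by rwa [uIcc_of_le hT.le]))
  -- the energy identity for `D W`, `D` symmetric and commuting with `J`
  have henergy : ∀ D : X →L[ℝ] X, (∀ x y, inner ℝ (D x) y = inner ℝ x (D y)) →
      (∀ x, D (J x) = J (D x)) → ∀ t ∈ Icc 0 T,
      ‖ι (D (W t))‖ ^ 2 = ‖ι (D (W 0))‖ ^ 2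
        + 2 * ∫ s in (0 : ℝ)..t, inner ℝ (D (J (D (J (u s))))) (g s) := by
    intro D hD hDJ t ht
    -- `‖ι D x‖²` is the quadratic form of `D J D`; under the integral `W` equals `J u` almost
    -- everywhere.
    have hq := quadratic_form_primitive (D ∘L J ∘L D) (fun x y => by
      simp only [ContinuousLinearMap.comp_apply]; rw [hD, hJs, hD]) c (hgt t ht)
    have hn : ∀ x, inner ℝ ((D ∘L J ∘L D) x) x = ‖ι (D x)‖ ^ 2 := fun x => by
      simp only [ContinuousLinearMap.comp_apply]
      rw [hD, hJ, real_inner_self_eq_norm_sq]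
    rw [hn, hn] at hq
    rw [hW0, ← sub_eq_iff_eq_add', hq]
    congr 1
    refine intervalIntegral_congr_timeMeas ht ?_
    filter_upwards [hc] with s hs
    rw [← hs]; rfl
  -- errors of the approximation
  set δ : ℕ → ℝ → ℝ := fun n t => ‖u t - R n (J (u t))‖ with hδ
  set a : ℕ → ℝ := fun n => ∫ t in Ioo 0 T, δ n t * ‖g t‖ with ha
  have hDb : ∀ n x, ‖(ContinuousLinearMap.id ℝ X - R n ∘L J) x‖ ≤ 3 * ‖x‖ := fun n x => by
    change ‖x - R n (J x)‖ ≤ _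
    linarith [norm_sub_le x (R n (J x)), hRb n x]
  have hDt : ∀ x, Tendsto (fun n => (ContinuousLinearMap.id ℝ X - R n ∘L J) x) atTop (𝓝 0) :=
    fun x => by simpa using (hRt x).const_sub x
  have hat : Tendsto a atTop (𝓝 0) := tendsto_integral_norm_mul_norm hu hg _ hDb hDt
  have hδi : ∀ n, Integrable (fun t => δ n t * ‖g t‖) (timeMeas T) := fun n => by
    have h1 : MemLp (fun t => δ n t) 2 (timeMeas T) :=
      ((ContinuousLinearMap.id ℝ X - R n ∘L J).comp_memLp' hu).norm
    exact h1.integrable_mul hg.norm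
  -- At `s₀` the approximations are known to converge, which is not known at time `0`; `s₀` anchors
  -- the uniform Cauchy estimate.
  obtain ⟨s₀, hs₀, hs₀W⟩ : ∃ s₀ ∈ Ioo 0 T, J (u s₀) = W s₀ := by
    have hne : (ae (timeMeas T)).NeBot := by
      rw [ae_neBot, Ne, Measure.restrict_eq_zero]
      simp [hT]
    obtain ⟨s, hs1, hs2⟩ := ((ae_restrict_mem measurableSet_Ioo).and hc).exists
    exact ⟨s, hs1, hs2⟩
  have hs₀' : s₀ ∈ Icc 0 T := Ioo_subset_Icc_self hs₀
  set v : ℕ → ℝ → H := fun n t => ι (R n (W t)) with hv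
  have hvW : ∀ n, ContinuousOn (v n) (Icc 0 T) := fun n =>
    (ι.continuous.comp (R n).continuous).comp_continuousOn hWc
  have hvt : ∀ t, J (u t) = W t → Tendsto (fun n => v n t) atTop (𝓝 (ι (u t))) := fun t ht => by
    simp only [hv, ← ht]
    exact (ι.continuous.tendsto _).comp (hRt (u t))
  -- The energy identities at `t` and `s₀` are subtracted: two integrals, each at most `4 (a n + a
  -- m)`, each with the factor `2`.
  have hDnm : ∀ n m, ∀ t ∈ Icc 0 T, ‖v n t - v m t‖ ^ 2
      ≤ ‖v n s₀ - v m s₀‖ ^ 2 + 2 * (2 * (4 * (a n + a m))) := by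
    intro n m t ht
    set D : X →L[ℝ] X := R n - R m with hDdef
    have hvD : ∀ r, v n r - v m r = ι (D (W r)) := fun r => by simp [hv, hDdef]
    have hE := henergy D (fun x y => by simp [hDdef, inner_sub_left, inner_sub_right, hRs])
      (fun x => by simp [hDdef, hRJ])
    have hDJ : ∀ x, ‖D (J x)‖ ≤ 4 * ‖x‖ := fun x => by
      change ‖R n (J x) - R m (J x)‖ ≤ _
      linarith [norm_sub_le (R n (J x)) (R m (J x)), hRb n x, hRb m x]
    have hDδ : ∀ r, ‖D (J (u r))‖ ≤ δ n r + δ m r := fun r => by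
      change ‖R n (J (u r)) - R m (J (u r))‖ ≤ _
      have e : R n (J (u r)) - R m (J (u r))
          = (u r - R m (J (u r))) - (u r - R n (J (u r))) := by abel
      rw [e, add_comm]
      exact norm_sub_le _ _
    have hI : ∀ r ∈ Icc 0 T, |∫ s in (0 : ℝ)..r, inner ℝ (D (J (D (J (u s))))) (g s)|
        ≤ 4 * (a n + a m) := by
      intro r hr
      have hsum : Integrable (fun s => 4 * (δ n s * ‖g s‖ + δ m s * ‖g s‖)) (timeMeas T) :=
        ((hδi n).add (hδi m)).const_mul 4
      have hnn : ∀ s, 0 ≤ 4 * (δ n s * ‖g s‖ + δ m s * ‖g s‖) := fun s => by positivity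
      rw [intervalIntegral.integral_of_le hr.1, integral_Ioc_eq_integral_Ioo]
      calc |∫ s in Ioo 0 r, inner ℝ (D (J (D (J (u s))))) (g s)|
          ≤ ∫ s in Ioo 0 r, 4 * (δ n s * ‖g s‖ + δ m s * ‖g s‖) := by
            rw [← Real.norm_eq_abs]
            refine norm_integral_le_of_norm_le
              (hsum.mono_measure (Measure.restrict_mono (Ioo_subset_Ioo_right hr.2) le_rfl))
              (Eventually.of_forall fun s => ?_)
            refine (norm_inner_le_norm _ _).trans ?_
            have h1 := (hDJ (D (J (u s)))).trans
              (mul_le_mul_of_nonneg_left (hDδ s) (by norm_num))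
            have := mul_le_mul_of_nonneg_right h1 (norm_nonneg (g s))
            linarith
        _ ≤ ∫ s in Ioo 0 T, 4 * (δ n s * ‖g s‖ + δ m s * ‖g s‖) :=
            setIntegral_mono_set hsum (Eventually.of_forall hnn)
              (Ioo_subset_Ioo_right hr.2).eventuallyLE
        _ = 4 * (a n + a m) := by
            rw [integral_const_mul, integral_add (hδi n) (hδi m)]
    rw [hvD, hvD, hE t ht, hE s₀ hs₀']
    have h1 := (abs_le.1 (hI t ht)).2
    have h2 := (abs_le.1 (hI s₀ hs₀')).1
    linarith
  have hcau : UniformCauchySeqOn v atTop (Icc 0 T) := by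
    rw [Metric.uniformCauchySeqOn_iff]
    intro ε hε
    obtain ⟨N₁, hN₁⟩ := Metric.cauchySeq_iff.1 (hvt s₀ hs₀W).cauchySeq (ε / 2) (half_pos hε)
    -- With this choice `16 (a n + a m) < ε² / 2`, which together with `(ε / 2)²` stays below `ε²`.
    obtain ⟨N₂, hN₂⟩ := (hat.eventually
      (gt_mem_nhds (show 0 < ε ^ 2 / 64 by positivity))).exists_forall_of_atTop
    refine ⟨max N₁ N₂, fun n hn m hm t ht => ?_⟩
    have h1 := hN₁ n (le_of_max_le_left hn) m (le_of_max_le_left hm)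
    have h2 := hN₂ n (le_of_max_le_right hn)
    have h3 := hN₂ m (le_of_max_le_right hm)
    rw [dist_eq_norm] at h1 ⊢
    have h4 : ‖v n s₀ - v m s₀‖ ^ 2 ≤ (ε / 2) ^ 2 := by gcongr
    refine lt_of_pow_lt_pow_left₀ 2 hε.le ?_
    nlinarith [hDnm n m t ht, sq_pos_of_pos hε]
  have hlim : ∀ t ∈ Icc 0 T, ∃ y, Tendsto (fun n => v n t) atTop (𝓝 y) := fun t ht =>
    cauchySeq_tendsto_of_complete (hcau.cauchySeq ht)
  choose! w hw using hlim
  have hunif : TendstoUniformlyOn v w atTop (Icc 0 T) :=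
    hcau.tendstoUniformlyOn_of_tendsto hw
  refine ⟨w, hunif.continuousOn (Frequently.of_forall hvW), ?_, ?_⟩
  · filter_upwards [hc, ae_restrict_mem measurableSet_Ioo] with t ht htT
    exact tendsto_nhds_unique (hw t (Ioo_subset_Icc_self htT)) (hvt t ht)
  · intro t ht
    have hRR : ∀ x, Tendsto (fun n => R n (J (R n (J x)))) atTop (𝓝 x) := fun x => by
      have h1 : Tendsto (fun n => R n (J (R n (J x) - x))) atTop (𝓝 0) := by
        refine squeeze_zero_norm (fun n => hRb n _) ?_
        simpa using (((hRt x).sub_const x).norm.const_mul 2)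
      simpa using h1.add (hRt x)
    have hint : Tendsto
        (fun n => ∫ s in (0 : ℝ)..t, inner ℝ (R n (J (R n (J (u s))))) (g s)) atTop
        (𝓝 (∫ s in (0 : ℝ)..t, inner ℝ (u s) (g s))) := by
      simp only [intervalIntegral.integral_of_le ht.1, integral_Ioc_eq_integral_Ioo]
      have hle : volume.restrict (Ioo 0 t) ≤ timeMeas T :=
        Measure.restrict_mono (Ioo_subset_Ioo_right ht.2) le_rfl
      refine tendsto_integral_of_dominated_convergence (fun s => 4 * (‖u s‖ * ‖g s‖))
        (fun n => ?_) ?_ (fun n => Eventually.of_forall fun s => ?_)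
        (Eventually.of_forall fun s => (hRR (u s)).inner tendsto_const_nhds)
      · exact (((R n ∘L J ∘L R n ∘L J).continuous.comp_aestronglyMeasurable hu.1).inner
          hg.1).mono_measure hle
      · exact ((hu.norm.integrable_mul hg.norm).const_mul 4).mono_measure hle
      · refine (norm_inner_le_norm _ _).trans ?_
        have h1 := (hRb n (R n (J (u s)))).trans
          (mul_le_mul_of_nonneg_left (hRb n (u s)) (by norm_num))
        have := mul_le_mul_of_nonneg_right h1 (norm_nonneg (g s))
        linarith
    have h0 : (0 : ℝ) ∈ Icc 0 T := ⟨le_rfl, hT.le⟩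
    refine tendsto_nhds_unique ((hw t ht).norm.pow 2) ?_
    refine (((hw 0 h0).norm.pow 2).add (hint.const_mul 2)).congr fun n => ?_
    exact (henergy (R n) (hRs n) (hRJ n) t ht).symm

end LionsMagenes

/-! ### The bilinear forms as inner products -/

section Pairings

variable {Ω : Set E}

lemma ip_eq_inner (f g : L2 Ω) : ip Ω f g = inner ℝ f g := by
  rw [ip, L2.inner_def]
  congr 1 with x
  rw [PiLp.inner_apply]
  exact Finset.sum_congr rfl fun i _ => mul_comm _ _

lemma integral_frobenius_eq_inner (f g : L2Mat Ω) :
    ∫ x in Ω, ∑ i, ∑ j, f x (i, j) * g x (i, j) = inner ℝ f g := by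
  rw [L2.inner_def]
  congr 1 with x
  rw [PiLp.inner_apply, Fintype.sum_prod_type]
  exact Finset.sum_congr rfl fun i _ => Finset.sum_congr rfl fun j _ => mul_comm _ _

/-- The porosity term has a nonnegative integrand. Integrability plays no role, since a
non-integrable function has integral `0` by convention. -/
lemma aForm_self_ge {μ : ℝ} {α : ℝ → ℝ} (hα : ∀ s, 0 ≤ α s) (φ : E → ℝ) (v : V Ω) :
    μ * ‖dfld v‖ ^ 2 ≤ aForm Ω μ α φ v v := by
  rw [aForm, integral_frobenius_eq_inner, real_inner_self_eq_norm_sq]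
  refine le_add_of_nonneg_right (integral_nonneg fun x => mul_nonneg (hα _) ?_)
  exact Finset.sum_nonneg fun i _ => mul_self_nonneg _

/-- Pairing an `L²` field with a component of a fixed `L²` field, as an inner product. -/
lemma inner_toLp_single {κ : Type*} [Fintype κ] [DecidableEq κ]
    (f : Lp (EuclideanSpace ℝ κ) 2 (volume.restrict Ω)) (i : κ) {k : E → ℝ}
    (hk : MemLp (fun x => EuclideanSpace.single i (k x)) 2 (volume.restrict Ω)) :
    inner ℝ f (hk.toLp _) = ∫ x in Ω, f x i * k x := by
  rw [L2.inner_def]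
  refine integral_congr_ae ?_
  filter_upwards [hk.coeFn_toLp] with x hx
  rw [hx, EuclideanSpace.inner_single_right]
  simp [mul_comm]

end Pairings

/-! ### Bounds for the convective form -/

section Trilinear

variable {Ω : Set E}

/-- The sum is the Frobenius product of `M` with the rank-one matrix `b ⊗ a`, whose norm is `‖a‖
‖b‖`; Cauchy–Schwarz applies. -/
lemma abs_trilinear_le (a : E) (M : Mat) (b : E) :
    |∑ i, ∑ j, a j * M (i, j) * b i| ≤ ‖a‖ * ‖b‖ * ‖M‖ := by
  set N : Mat := WithLp.toLp 2 fun p => a p.2 * b p.1 with hN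
  have h1 : ∑ i, ∑ j, a j * M (i, j) * b i = inner ℝ N M := by
    rw [PiLp.inner_apply, Fintype.sum_prod_type]
    refine Finset.sum_congr rfl fun i _ => Finset.sum_congr rfl fun j _ => ?_
    simp only [hN, real_inner_eq_re_inner]
    simp
    ring
  have h2 : ‖N‖ = ‖a‖ * ‖b‖ := by
    rw [← sq_eq_sq₀ (norm_nonneg _) (by positivity), mul_pow, EuclideanSpace.norm_sq_eq,
      EuclideanSpace.norm_sq_eq, EuclideanSpace.norm_sq_eq, Fintype.sum_prod_type]
    simp only [hN, Fin.sum_univ_two, Real.norm_eq_abs, sq_abs]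
    ring
  rw [h1, ← h2]
  exact abs_real_inner_le_norm _ _

lemma aestronglyMeasurable_trilinear {m : Measure E} {u w : E → E} {G : E → Mat}
    (hu : AEStronglyMeasurable u m) (hG : AEStronglyMeasurable G m)
    (hw : AEStronglyMeasurable w m) :
    AEStronglyMeasurable (fun x => ∑ i, ∑ j, u x j * G x (i, j) * w x i) m := by
  have hc : ∀ {κ : Type} [Fintype κ] {f : E → EuclideanSpace ℝ κ} (i : κ),
      AEStronglyMeasurable f m → AEStronglyMeasurable (fun x => f x i) m := fun i hf =>
    (EuclideanSpace.proj (𝕜 := ℝ) i).continuous.comp_aestronglyMeasurable hf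
  refine Finset.aestronglyMeasurable_fun_sum _ fun i _ =>
    Finset.aestronglyMeasurable_fun_sum _ fun j _ => ?_
  exact ((hc j hu).mul (hc (i, j) hG)).mul (hc i hw)

lemma holderTriple_four_four_two : ENNReal.HolderTriple 4 4 2 := by
  constructor
  rw [← two_mul]
  have : (4 : ℝ≥0∞) = 2 * 2 := by norm_num
  rw [this, ENNReal.mul_inv (by simp) (by simp), ← mul_assoc,
    ENNReal.mul_inv_cancel (by simp) (by simp), one_mul]

/-- Hölder twice: `4, 4 → 2` for `‖u‖ ‖w‖`, then `2, 2 → 1` against `‖G‖`. -/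
lemma trilinear_bound {m : Measure E} {u w : E → E} {G : E → Mat}
    (hu : MemLp u 4 m) (hG : MemLp G 2 m) (hw : MemLp w 4 m) :
    Integrable (fun x => ∑ i, ∑ j, u x j * G x (i, j) * w x i) m ∧
      |∫ x, ∑ i, ∑ j, u x j * G x (i, j) * w x i ∂m|
        ≤ (eLpNorm u 4 m).toReal * (eLpNorm w 4 m).toReal * (eLpNorm G 2 m).toReal := by
  have := holderTriple_four_four_two
  have h1 : eLpNorm (fun x => ‖u x‖ * ‖w x‖) 2 m ≤ eLpNorm u 4 m * eLpNorm w 4 m := by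
    have := eLpNorm_smul_le_mul_eLpNorm (p := 4) (q := 4) (r := 2) hw.1.norm hu.1.norm
    rwa [eLpNorm_norm, eLpNorm_norm] at this
  have h2 : eLpNorm (fun x => ‖u x‖ * ‖w x‖ * ‖G x‖) 1 m
      ≤ eLpNorm u 4 m * eLpNorm w 4 m * eLpNorm G 2 m := by
    have := eLpNorm_smul_le_mul_eLpNorm (p := 2) (q := 2) (r := 1) hG.1.norm
      (hu.1.norm.mul hw.1.norm)
    rw [eLpNorm_norm] at this
    exact this.trans (mul_le_mul_left h1 _)
  have hfin : eLpNorm u 4 m * eLpNorm w 4 m * eLpNorm G 2 m ≠ ⊤ :=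
    ENNReal.mul_ne_top (ENNReal.mul_ne_top hu.2.ne hw.2.ne) hG.2.ne
  have hint : Integrable (fun x => ‖u x‖ * ‖w x‖ * ‖G x‖) m :=
    memLp_one_iff_integrable.1
      ⟨(hu.1.norm.mul hw.1.norm).mul hG.1.norm, h2.trans_lt hfin.lt_top⟩
  refine ⟨hint.mono' (aestronglyMeasurable_trilinear hu.1 hG.1 hw.1)
    (Eventually.of_forall fun x => abs_trilinear_le _ _ _), ?_⟩
  calc |∫ x, ∑ i, ∑ j, u x j * G x (i, j) * w x i ∂m|
      ≤ ∫ x, ‖u x‖ * ‖w x‖ * ‖G x‖ ∂m := by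
        rw [← Real.norm_eq_abs]
        exact norm_integral_le_of_norm_le hint (Eventually.of_forall fun x => abs_trilinear_le _ _ _)
    _ = (eLpNorm (fun x => ‖u x‖ * ‖w x‖ * ‖G x‖) 1 m).toReal := by
        rw [eLpNorm_one_eq_lintegral_enorm,
          ← integral_norm_eq_lintegral_enorm hint.aestronglyMeasurable]
        congr 1 with x
        rw [Real.norm_of_nonneg (by positivity)]
    _ ≤ _ := by
        rw [← ENNReal.toReal_mul, ← ENNReal.toReal_mul]
        exact ENNReal.toReal_mono hfin h2

lemma abs_bForm_le {u w : E → E} (hu : MemLp u 4 (volume.restrict Ω)) (G : L2Mat Ω)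
    (hw : MemLp w 4 (volume.restrict Ω)) :
    |bForm Ω u G w| ≤ (eLpNorm u 4 (volume.restrict Ω)).toReal *
      (eLpNorm w 4 (volume.restrict Ω)).toReal * ‖G‖ :=
  (trilinear_bound hu (Lp.memLp G) hw).2

lemma bForm_congr {u : E → E} {G G' : E → Mat} {w w' : E → E}
    (hG : G =ᵐ[volume.restrict Ω] G') (hw : w =ᵐ[volume.restrict Ω] w') :
    bForm Ω u G w = bForm Ω u G' w' := by
  refine integral_congr_ae ?_
  filter_upwards [hG, hw] with x h1 h2
  rw [h1, h2]

lemma bForm_sub_grad {u w : E → E} (hu : MemLp u 4 (volume.restrict Ω)) (G G' : L2Mat Ω)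
    (hw : MemLp w 4 (volume.restrict Ω)) :
    bForm Ω u (G - G' : L2Mat Ω) w = bForm Ω u G w - bForm Ω u G' w := by
  rw [bForm_congr (Lp.coeFn_sub G G') (ae_eq_refl w), bForm, bForm, bForm,
    ← integral_sub (trilinear_bound hu (Lp.memLp G) hw).1 (trilinear_bound hu (Lp.memLp G') hw).1]
  congr 1 with x
  simp only [← Finset.sum_sub_distrib]
  refine Finset.sum_congr rfl fun i _ => Finset.sum_congr rfl fun j _ => ?_
  simp only [Pi.sub_apply, PiLp.sub_apply]; ring

lemma bForm_sub_field {u : E → E} (hu : MemLp u 4 (volume.restrict Ω)) (G : L2Mat Ω)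
    (w w' : L2 Ω) (hw : MemLp w 4 (volume.restrict Ω)) (hw' : MemLp w' 4 (volume.restrict Ω)) :
    bForm Ω u G (w - w' : L2 Ω) = bForm Ω u G w - bForm Ω u G w' := by
  rw [bForm_congr (ae_eq_refl _) (Lp.coeFn_sub w w'), bForm, bForm, bForm,
    ← integral_sub (trilinear_bound hu (Lp.memLp G) hw).1 (trilinear_bound hu (Lp.memLp G) hw').1]
  congr 1 with x
  simp only [← Finset.sum_sub_distrib]
  refine Finset.sum_congr rfl fun i _ => Finset.sum_congr rfl fun j _ => ?_
  simp only [Pi.sub_apply, PiLp.sub_apply]; ring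

end Trilinear

/-! ### The cancellation `b(u, v, v) = 0` -/

section Ladyzhenskaya

variable {Ω : Set E} {cL : ℝ}

lemma IsLadyzhenskayaConst.memLp (h : IsLadyzhenskayaConst Ω cL) {p : Pair Ω} (hp : p ∈ H10 Ω) :
    MemLp p.fst 4 (volume.restrict Ω) :=
  ⟨Lp.aestronglyMeasurable _, (h.2 p hp).trans_lt ENNReal.ofReal_lt_top⟩

lemma IsLadyzhenskayaConst.toReal_le (h : IsLadyzhenskayaConst Ω cL) {p : Pair Ω}
    (hp : p ∈ H10 Ω) :
    (eLpNorm p.fst 4 (volume.restrict Ω)).toReal ≤ √cL * √‖p.fst‖ * √‖p.snd‖ :=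
  ENNReal.toReal_le_of_le_ofReal (by positivity) (h.2 p hp)

lemma norm_fst_le (p : Pair Ω) : ‖p.fst‖ ≤ ‖p‖ := by
  refine le_of_sq_le_sq ?_ (norm_nonneg _)
  rw [WithLp.prod_norm_sq_eq_of_L2]
  exact le_add_of_nonneg_right (by positivity)

lemma norm_snd_le (p : Pair Ω) : ‖p.snd‖ ≤ ‖p‖ := by
  refine le_of_sq_le_sq ?_ (norm_nonneg _)
  rw [WithLp.prod_norm_sq_eq_of_L2]
  exact le_add_of_nonneg_left (by positivity)

/-- This cruder form makes `b(u, ·, ·)` continuous in the `H¹` norm, as the density argument below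
requires. -/
lemma IsLadyzhenskayaConst.toReal_le_norm (h : IsLadyzhenskayaConst Ω cL) {p : Pair Ω}
    (hp : p ∈ H10 Ω) :
    (eLpNorm p.fst 4 (volume.restrict Ω)).toReal ≤ √cL * ‖p‖ := by
  refine (h.toReal_le hp).trans ?_
  rw [mul_assoc]
  refine mul_le_mul_of_nonneg_left ?_ (Real.sqrt_nonneg _)
  calc √‖p.fst‖ * √‖p.snd‖ ≤ √‖p‖ * √‖p‖ := by
        gcongr
        · exact norm_fst_le p
        · exact norm_snd_le p
    _ = ‖p‖ := Real.mul_self_sqrt (norm_nonneg _)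

/-- `b(u, θ, θ) = 0` for divergence free `u` and smooth compactly supported `θ`. -/
lemma bForm_test_self_eq_zero {u : E → E} (hdiv : IsDivFree Ω u) {θ : E → E} (hθ : IsTest Ω θ) :
    bForm Ω u (grad θ) θ = 0 := by
  have hs : Function.support (fun x => ‖θ x‖ ^ 2) ⊆ Function.support θ := by
    intro x hx hx0
    exact hx (by simp [hx0])
  have ht : IsTest Ω (fun x => ‖θ x‖ ^ 2) :=
    ⟨hθ.1.norm_sq ℝ, hθ.2.1.mono hs, (closure_mono hs).trans hθ.2.2⟩
  have h := hdiv _ ht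
  -- The identity is `u · ∇|θ|² = 2 [(u · ∇)θ] · θ`, with `|θ|²` admissible as a test function.
  have e : (fun x => ∑ j, u x j * pd j (fun x => ‖θ x‖ ^ 2) x)
      = fun x => 2 * ∑ i, ∑ j, u x j * grad θ x (i, j) * θ x i := by
    ext x
    have hd : HasFDerivAt θ (fderiv ℝ θ x) x :=
      (hθ.1.differentiable (by simp)).differentiableAt.hasFDerivAt
    have hpd : ∀ j, pd j (fun x => ‖θ x‖ ^ 2) x = 2 * ∑ i, grad θ x (i, j) * θ x i := by
      intro j
      rw [pd, hd.norm_sq.fderiv]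
      simp [PiLp.inner_apply, grad, pd, mul_add]
    simp only [hpd, Finset.mul_sum]
    rw [Finset.sum_comm]
    refine Finset.sum_congr rfl fun i _ => Finset.sum_congr rfl fun j _ => ?_
    ring
  rw [e, integral_const_mul] at h
  rw [bForm]
  linarith

/-- `b(u, v, v) = 0` for divergence free `u ∈ L⁴` and `v ∈ H¹₀`. -/
lemma bForm_self_eq_zero (hcL : IsLadyzhenskayaConst Ω cL) {u : E → E}
    (hu : MemLp u 4 (volume.restrict Ω)) (hdiv : IsDivFree Ω u) {p : Pair Ω} (hp : p ∈ H10 Ω) :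
    bForm Ω u p.snd p.fst = 0 := by
  obtain ⟨q, hq, hqt⟩ := mem_closure_iff_seq_limit.1
    (show p ∈ closure (testPairs Ω : Set (Pair Ω)) from hp)
  have hqH : ∀ n, q n ∈ H10 Ω := fun n => subset_closure (hq n)
  have hq0 : ∀ n, bForm Ω u (q n).snd (q n).fst = 0 := by
    intro n
    obtain ⟨θ, hθ, h1, h2⟩ := hq n
    rw [bForm_congr h2 h1]
    exact bForm_test_self_eq_zero hdiv hθ
  set K := (eLpNorm u 4 (volume.restrict Ω)).toReal
  have hK : 0 ≤ K := ENNReal.toReal_nonneg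
  -- Since `b(u, q, q) = 0`, one has `b(u, p, p) = b(u, p - q, p) + b(u, q, p - q)`. The
  -- approximants `q` need not be divergence free.
  have hle : ∀ n, |bForm Ω u p.snd p.fst|
      ≤ K * (√cL * ‖p‖) * ‖p - q n‖ + K * (√cL * ‖p - q n‖) * ‖q n‖ := by
    intro n
    have hpq : p - q n ∈ H10 Ω := sub_mem hp (hqH n)
    have e1 := bForm_sub_grad hu p.snd (q n).snd (hcL.memLp hp)
    have e2 := bForm_sub_field hu (q n).snd p.fst (q n).fst (hcL.memLp hp) (hcL.memLp (hqH n))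
    have e3 : bForm Ω u p.snd p.fst = bForm Ω u (p - q n).snd p.fst
        + bForm Ω u (q n).snd (p - q n).fst := by
      rw [WithLp.sub_snd, WithLp.sub_fst, e1, e2, hq0 n]; ring
    rw [e3]
    refine (abs_add_le _ _).trans (add_le_add ?_ ?_)
    · refine (abs_bForm_le hu _ (hcL.memLp hp)).trans ?_
      gcongr
      · exact hcL.toReal_le_norm hp
      · exact norm_snd_le _
    · refine (abs_bForm_le hu _ (hcL.memLp hpq)).trans ?_
      gcongr
      · exact hcL.toReal_le_norm hpq
      · exact norm_snd_le _
  have h0 : Tendsto (fun n => ‖p - q n‖) atTop (𝓝 0) := by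
    simpa using (hqt.const_sub p).norm
  have hlim : Tendsto (fun n => K * (√cL * ‖p‖) * ‖p - q n‖ + K * (√cL * ‖p - q n‖) * ‖q n‖)
      atTop (𝓝 0) := by
    simpa using (h0.const_mul (K * (√cL * ‖p‖))).add
      (((h0.const_mul (√cL)).const_mul K).mul hqt.norm)
  exact abs_nonpos_iff.1 (ge_of_tendsto' hlim hle)

end Ladyzhenskaya

/-! ### The space `V` and its embedding into `L²` -/

section Space

variable {Ω : Set E}

lemma memLp_single_of_continuous {κ : Type*} [Fintype κ] [DecidableEq κ] (i : κ) {k : E → ℝ}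
    (hk : Continuous k) (hc : HasCompactSupport k) :
    MemLp (fun x => (EuclideanSpace.single i (k x) : EuclideanSpace ℝ κ)) 2
      (volume.restrict Ω) := by
  have h1 : MemLp k 2 (volume.restrict Ω) := (hk.memLp_of_hasCompactSupport hc).restrict Ω
  refine MemLp.of_le h1 ?_ (Eventually.of_forall fun x => by simp)
  have : (fun x => (EuclideanSpace.single i (k x) : EuclideanSpace ℝ κ))
      = fun x => k x • EuclideanSpace.single i (1 : ℝ) := by
    ext x j; simp
  rw [this]
  exact (hk.smul continuous_const).aestronglyMeasurable

/-- The matrix part of an element of `H¹₀` is the weak gradient of its field. -/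
lemma isWeakGrad_of_mem_H10 {p : Pair Ω} (hp : p ∈ H10 Ω) : IsWeakGrad Ω p.fst p.snd := by
  intro i j η hη
  have hη' : Continuous (pd j η) := by
    exact (hη.1.continuous_fderiv (by simp)).clm_apply continuous_const
  have hηc : HasCompactSupport (pd j η) := hη.2.1.fderiv_apply (𝕜 := ℝ) _
  have hA := memLp_single_of_continuous (Ω := Ω) i hη' hηc
  have hB := memLp_single_of_continuous (Ω := Ω) (i, j) hη.1.continuous hη.2.1
  -- As an equality of `L²` inner products the weak-gradient identity is a closed condition on the
  -- pair, so test pairs suffice; there it is integration by parts on the whole plane.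
  have key : ∀ q : Pair Ω, q ∈ closure (testPairs Ω : Set (Pair Ω)) →
      inner ℝ q.fst (hA.toLp _) = - inner ℝ q.snd (hB.toLp _) := by
    intro q hq
    have hcl : IsClosed {q : Pair Ω | inner ℝ q.fst (hA.toLp _) = - inner ℝ q.snd (hB.toLp _)} :=
      isClosed_eq ((WithLp.fstL 2 ℝ (L2 Ω) (L2Mat Ω)).continuous.inner continuous_const)
        ((WithLp.sndL 2 ℝ (L2 Ω) (L2Mat Ω)).continuous.inner continuous_const).neg
    refine closure_minimal ?_ hcl hq
    rintro r ⟨θ, hθ, h1, h2⟩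
    change inner ℝ r.fst (hA.toLp _) = - inner ℝ r.snd (hB.toLp _)
    rw [inner_toLp_single, inner_toLp_single]
    have e1 : ∫ x in Ω, r.fst x i * pd j η x = ∫ x, θ x i * pd j η x := by
      refine (integral_congr_ae (g := fun x => θ x i * pd j η x) ?_).trans
        (setIntegral_eq_integral_of_forall_compl_eq_zero ?_)
      · filter_upwards [h1] with x hx
        rw [hx]
      · intro x hx
        rw [image_eq_zero_of_notMem_tsupport fun h => hx (hθ.2.2 h)]; simp
    have e2 : ∫ x in Ω, r.snd x (i, j) * η x = ∫ x, pd j θ x i * η x := by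
      refine (integral_congr_ae (g := fun x => pd j θ x i * η x) ?_).trans
        (setIntegral_eq_integral_of_forall_compl_eq_zero ?_)
      · filter_upwards [h2] with x hx
        rw [hx]; rfl
      · intro x hx
        rw [image_eq_zero_of_notMem_tsupport fun h => hx (hη.2.2 h)]; simp
    rw [e1, e2]
    have hθd : Differentiable ℝ θ := hθ.1.differentiable (by simp)
    have hθi : ∀ x, fderiv ℝ (fun x => θ x i) x (EuclideanSpace.single j 1) = pd j θ x i := by
      intro x
      have := ((EuclideanSpace.proj (𝕜 := ℝ) i).hasFDerivAt.comp x (hθd x).hasFDerivAt)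
      rw [show (fun x => θ x i) = (EuclideanSpace.proj (𝕜 := ℝ) i) ∘ θ from rfl, this.fderiv]
      rfl
    have hθic : Continuous fun x => θ x i :=
      (EuclideanSpace.proj (𝕜 := ℝ) i).continuous.comp hθ.1.continuous
    have hθ'c : Continuous fun x => pd j θ x i :=
      (EuclideanSpace.proj (𝕜 := ℝ) i).continuous.comp
        ((hθ.1.continuous_fderiv (by simp)).clm_apply continuous_const)
    simp only [← hθi]
    refine integral_mul_fderiv_eq_neg_fderiv_mul_of_integrable ?_ ?_ ?_ ?_ ?_
    · simp only [hθi]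
      exact (hθ'c.mul hη.1.continuous).integrable_of_hasCompactSupport hη.2.1.mul_left
    · exact (hθic.mul hη').integrable_of_hasCompactSupport hηc.mul_left
    · exact (hθic.mul hη.1.continuous).integrable_of_hasCompactSupport hη.2.1.mul_left
    · exact fun x _ => ((EuclideanSpace.proj (𝕜 := ℝ) i).differentiableAt).comp x (hθd x)
    · exact fun x _ => (hη.1.differentiable (by simp)) x
  have := key p hp
  rwa [inner_toLp_single, inner_toLp_single] at this

/-- An element of `H¹₀` is determined by its field. -/
lemma snd_eq_zero_of_fst_eq_zero (hΩ : IsOpen Ω) {p : Pair Ω} (hp : p ∈ H10 Ω)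
    (h0 : p.fst = 0) : p.snd = 0 := by
  have hz : ∀ q : Fin 2 × Fin 2, ∀ᵐ x ∂(volume.restrict Ω), p.snd x q = 0 := by
    rintro ⟨i, j⟩
    have hm : MemLp (fun x => p.snd x (i, j)) 2 (volume.restrict Ω) :=
      (EuclideanSpace.proj (𝕜 := ℝ) (i, j)).comp_memLp' (Lp.memLp p.snd)
    have hli : LocallyIntegrableOn (fun x => p.snd x (i, j)) Ω :=
      locallyIntegrableOn_of_locallyIntegrable_restrict (hm.locallyIntegrable (by norm_num))
    rw [ae_restrict_iff' hΩ.measurableSet]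
    refine hΩ.ae_eq_zero_of_integral_contDiff_smul_eq_zero hli fun η h1 h2 h3 => ?_
    have h := isWeakGrad_of_mem_H10 hp i j η ⟨h1, h2, h3⟩
    have e1 : ∫ x in Ω, p.fst x i * pd j η x = 0 := by
      refine integral_eq_zero_of_ae ?_
      rw [h0]
      filter_upwards [Lp.coeFn_zero E 2 (volume.restrict Ω)] with x hx
      rw [hx]; simp
    rw [e1, zero_eq_neg] at h
    rw [← h, ← setIntegral_eq_integral_of_forall_compl_eq_zero (s := Ω)]
    · simp only [smul_eq_mul, mul_comm]
    · intro x hx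
      rw [image_eq_zero_of_notMem_tsupport fun h => hx (h3 h), zero_smul]
  refine (Lp.eq_zero_iff_ae_eq_zero).2 ?_
  filter_upwards [ae_all_iff.2 hz] with x hx
  ext q
  exact hx q

/-- The embedding of `V` into `L²`. -/
def fldL (Ω : Set E) : V Ω →L[ℝ] L2 Ω :=
  (WithLp.fstL 2 ℝ (L2 Ω) (L2Mat Ω)).comp (V Ω).subtypeL

lemma fldL_apply (v : V Ω) : fldL Ω v = fld v := rfl

/-- Elements of `V` are stored with their gradients, so injectivity rests on the gradient being
determined by the field. -/
lemma fldL_injective (hΩ : IsOpen Ω) : Function.Injective (fldL Ω) := by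
  rw [injective_iff_map_eq_zero]
  intro v hv
  have h2 := snd_eq_zero_of_fst_eq_zero hΩ v.2.1 hv
  refine Subtype.ext ?_
  have : ‖(v : Pair Ω)‖ ^ 2 = 0 := by
    rw [WithLp.prod_norm_sq_eq_of_L2, h2, show (v : Pair Ω).fst = 0 from hv]; simp
  simpa using this

/-- `V` is the intersection of the closed space `H10` with the kernel of the continuous trace map on
the gradient. Completeness gives access to Riesz and Lax–Milgram. -/
instance completeSpace_V : CompleteSpace (V Ω) := by
  let tr : Mat →L[ℝ] ℝ := ∑ i : Fin 2, EuclideanSpace.proj (i, i)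
  let L : Pair Ω →L[ℝ] Lp ℝ 2 (volume.restrict Ω) :=
    (tr.compLpL 2 (volume.restrict Ω)).comp (WithLp.sndL 2 ℝ (L2 Ω) (L2Mat Ω))
  have hL : ∀ p : Pair Ω, (∀ᵐ x ∂(volume.restrict Ω), ∑ i, p.snd x (i, i) = 0) ↔ L p = 0 := by
    intro p
    rw [Lp.eq_zero_iff_ae_eq_zero]
    have h := tr.coeFn_compLpL (p := 2) (μ := volume.restrict Ω) p.snd
    have e : ∀ M : Mat, tr M = ∑ i, M (i, i) := fun M => by
      simp [tr]
    constructor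
    · intro hp
      filter_upwards [h, hp] with x h1 h2
      exact h1.trans ((e _).trans h2)
    · intro hp
      filter_upwards [h, hp] with x h1 h2
      exact (e _).symm.trans (h1.symm.trans h2)
  have hcl : IsClosed (V Ω : Set (Pair Ω)) := by
    have : (V Ω : Set (Pair Ω)) = (H10 Ω : Set (Pair Ω)) ∩ L ⁻¹' {0} := by
      ext p
      exact and_congr Iff.rfl (hL p)
    rw [this]
    exact (Submodule.isClosed_topologicalClosure _).inter (isClosed_singleton.preimage L.continuous)
  exact hcl.completeSpace_coe

end Space

/-! ### The energy inequality -/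

section Energy

variable {Ω : Set E}

/-- Energy inequality at a fixed time: testing the equation with the solution itself. -/
lemma energy_inequality {μ cP cL : ℝ} (hμ : 0 < μ) (hcP : IsPoincareConst Ω cP)
    (hcL : IsLadyzhenskayaConst Ω cL) {α : ℝ → ℝ} (hα : ∀ s, 0 ≤ α s) (φ : E → ℝ)
    {G : L2Mat Ω} {u₂ : L4 Ω} (hdiv : IsDivFree Ω u₂) {F z : L2 Ω}
    (hbound : ‖G‖ ^ 2 ≤ ‖z‖ ^ 2) {v : V Ω} {d : ℝ}
    (h : d + aForm Ω μ α φ v v + bForm Ω (fld v) G (fld v) + bForm Ω u₂ (dfld v) (fld v)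
      = ip Ω F (fld v)) :
    2 * d ≤ (2 * cL ^ 2 / μ * ‖z‖ ^ 2 - μ / cP ^ 2) * ‖fld v‖ ^ 2
      + 2 * cP ^ 2 / μ * ‖F‖ ^ 2 := by
  have hv : (v : Pair Ω) ∈ H10 Ω := v.2.1
  have hP : ‖fld v‖ ≤ cP * ‖dfld v‖ := hcP.2 _ hv
  have hP0 := hcP.1
  have hL0 := hcL.1
  have h4 : MemLp (fld v) 4 (volume.restrict Ω) := hcL.memLp hv
  have ha := aForm_self_ge (μ := μ) hα φ v
  have hb2 : bForm Ω u₂ (dfld v) (fld v) = 0 := bForm_self_eq_zero hcL (Lp.memLp u₂) hdiv hv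
  have hGz : ‖G‖ ≤ ‖z‖ := le_of_sq_le_sq hbound (norm_nonneg _)
  have hb1 : |bForm Ω (fld v) G (fld v)| ≤ cL * ‖fld v‖ * ‖dfld v‖ * ‖z‖ := by
    refine (abs_bForm_le h4 G h4).trans ?_
    have hq : (eLpNorm (fld v) 4 (volume.restrict Ω)).toReal
        ≤ √cL * √‖fld v‖ * √‖dfld v‖ := hcL.toReal_le hv
    have hq2 : (eLpNorm (fld v) 4 (volume.restrict Ω)).toReal *
        (eLpNorm (fld v) 4 (volume.restrict Ω)).toReal ≤ cL * ‖fld v‖ * ‖dfld v‖ := by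
      refine (mul_self_le_mul_self ENNReal.toReal_nonneg hq).trans_eq ?_
      rw [← sq, mul_pow, mul_pow, Real.sq_sqrt hL0.le, Real.sq_sqrt (norm_nonneg _),
        Real.sq_sqrt (norm_nonneg _)]
    gcongr
  have hF : ip Ω F (fld v) ≤ ‖F‖ * (cP * ‖dfld v‖) := by
    rw [ip_eq_inner]
    refine (real_inner_le_norm _ _).trans ?_
    gcongr
  have hb1' := (abs_le.1 hb1).1
  set y := ‖fld v‖
  set g := ‖dfld v‖
  have hy : 0 ≤ y := norm_nonneg _
  have hg : 0 ≤ g := norm_nonneg _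
  -- Each of the two Young inequalities spends `μ / 2 * g ^ 2` of the available `2 * μ * g ^ 2`,
  -- leaving `μ * g ^ 2` for Poincaré.
  have hyoung1 : 2 * (cL * y * g * ‖z‖) ≤ μ / 2 * g ^ 2 + 2 * cL ^ 2 / μ * ‖z‖ ^ 2 * y ^ 2 := by
    have e : μ / 2 * g ^ 2 + 2 * cL ^ 2 / μ * ‖z‖ ^ 2 * y ^ 2 - 2 * (cL * y * g * ‖z‖)
        = (μ * g - 2 * (cL * y * ‖z‖)) ^ 2 / (2 * μ) := by field_simp; ring
    have : 0 ≤ (μ * g - 2 * (cL * y * ‖z‖)) ^ 2 / (2 * μ) := by positivity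
    linarith
  have hyoung2 : 2 * (‖F‖ * (cP * g)) ≤ μ / 2 * g ^ 2 + 2 * cP ^ 2 / μ * ‖F‖ ^ 2 := by
    have e : μ / 2 * g ^ 2 + 2 * cP ^ 2 / μ * ‖F‖ ^ 2 - 2 * (‖F‖ * (cP * g))
        = (μ * g - 2 * (cP * ‖F‖)) ^ 2 / (2 * μ) := by field_simp; ring
    have : 0 ≤ (μ * g - 2 * (cP * ‖F‖)) ^ 2 / (2 * μ) := by positivity
    linarith
  have hpoin : μ / cP ^ 2 * y ^ 2 ≤ μ * g ^ 2 := by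
    have h1 : y ^ 2 ≤ (cP * g) ^ 2 := by gcongr
    calc μ / cP ^ 2 * y ^ 2 ≤ μ / cP ^ 2 * (cP * g) ^ 2 := by gcongr
      _ = μ * g ^ 2 := by field_simp
  linarith

end Energy

/-! ### Gronwall's inequality -/

section Gronwall

/-- Gronwall's inequality for an absolutely continuous function given by its derivative. -/
lemma gronwall_of_integral {T : ℝ} {y r a f : ℝ → ℝ}
    (hr : IntervalIntegrable r volume 0 T) (ha : IntervalIntegrable a volume 0 T)
    (hf : IntervalIntegrable f volume 0 T)
    (hy : ∀ t ∈ Icc 0 T, y t = y 0 + ∫ s in (0 : ℝ)..t, r s)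
    (hle : ∀ᵐ t ∂(timeMeas T), r t ≤ a t * y t + f t) {t : ℝ} (ht : t ∈ Icc 0 T) :
    y t ≤ Real.exp (∫ s in (0 : ℝ)..t, a s) * y 0
      + ∫ s in (0 : ℝ)..t,
          Real.exp ((∫ x in (0 : ℝ)..t, a x) - ∫ x in (0 : ℝ)..s, a x) * f s := by
  have hsub : uIcc 0 t ⊆ uIcc 0 T := by
    rw [uIcc_of_le ht.1, uIcc_of_le (ht.1.trans ht.2)]; exact Icc_subset_Icc_right ht.2
  have hr := hr.mono_set hsub
  have ha := ha.mono_set hsub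
  have hf := hf.mono_set hsub
  set A : ℝ → ℝ := fun s => ∫ x in (0 : ℝ)..s, a x with hA
  -- `y` is prescribed only on `[0,T]`; `Y` agrees with it there and is defined by the integral
  -- everywhere, so it can be differentiated.
  set Y : ℝ → ℝ := fun s => y 0 + ∫ x in (0 : ℝ)..s, r x with hY
  have hAac : AbsolutelyContinuousOnInterval A 0 t :=
    ha.absolutelyContinuousOnInterval_intervalIntegral left_mem_uIcc
  have hRac : AbsolutelyContinuousOnInterval (fun s => ∫ x in (0 : ℝ)..s, r x) 0 t :=
    hr.absolutelyContinuousOnInterval_intervalIntegral left_mem_uIcc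
  have hYac : AbsolutelyContinuousOnInterval Y 0 t :=
    absolutelyContinuousOnInterval_of_dist_le (C := 1) hRac fun s _ r _ => by simp [hY]
  obtain ⟨M, hM⟩ := hAac.exists_bound
  have hEac : AbsolutelyContinuousOnInterval (fun s => Real.exp (-A s)) 0 t := by
    -- On `[0,t]` one has `-A ≤ M`, and `exp` is Lipschitz on `(-∞, M]`, so `exp (-A)` inherits
    -- absolute continuity.
    have hlip : LipschitzOnWith (Real.exp M).toNNReal Real.exp (Iic M) := by
      refine Convex.lipschitzOnWith_of_nnnorm_deriv_le (fun x _ => Real.differentiableAt_exp)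
        (fun x hx => ?_) (convex_Iic M)
      rw [← NNReal.coe_le_coe, coe_nnnorm, Real.deriv_exp, Real.norm_of_nonneg (Real.exp_pos _).le,
        Real.coe_toNNReal _ (Real.exp_pos _).le]
      exact Real.exp_le_exp.2 hx
    have hmem : ∀ s ∈ uIcc 0 t, -A s ∈ Iic M := fun s hs =>
      (neg_le_abs (A s)).trans (hM s hs)
    refine absolutelyContinuousOnInterval_of_dist_le (C := ((Real.exp M).toNNReal : ℝ)) hAac
      fun s hs r hr => ?_
    have := hlip.dist_le_mul _ (hmem s hs) _ (hmem r hr)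
    rwa [dist_neg_neg] at this
  have hder : ∀ᵐ s, s ∈ uIcc 0 t → HasDerivAt (fun s => Real.exp (-A s) * Y s)
      (Real.exp (-A s) * (r s - a s * Y s)) s := by
    filter_upwards [ha.ae_hasDerivAt_integral, hr.ae_hasDerivAt_integral] with s h1 h2 hs
    have h3 : HasDerivAt A (a s) s := h1 hs 0 left_mem_uIcc
    have h4 : HasDerivAt Y (r s) s := (h2 hs 0 left_mem_uIcc).const_add _
    convert! h3.neg.exp.mul h4 using 1
    simp only [Pi.neg_apply]
    ring
  have hftc := integral_eq_sub_of_absolutelyContinuous (hEac.fun_mul hYac) hder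
  have hEc : ContinuousOn (fun s => Real.exp (-A s)) (uIcc 0 t) := hEac.continuousOn
  have hmono : ∫ s in (0 : ℝ)..t, Real.exp (-A s) * (r s - a s * Y s)
      ≤ ∫ s in (0 : ℝ)..t, Real.exp (-A s) * f s := by
    refine intervalIntegral.integral_mono_ae_restrict ht.1
      ((hr.sub (ha.mul_continuousOn hYac.continuousOn)).continuousOn_mul hEc)
      (hf.continuousOn_mul hEc) ?_
    rw [← Measure.restrict_congr_set Ioo_ae_eq_Icc]
    filter_upwards [ae_restrict_of_ae_restrict_of_subset (Ioo_subset_Ioo_right ht.2) hle,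
      ae_restrict_mem measurableSet_Ioo] with s hs hst
    have hYs : Y s = y s := (hy s ⟨hst.1.le, hst.2.le.trans ht.2⟩).symm
    rw [hYs]
    exact mul_le_mul_of_nonneg_left (by linarith) (Real.exp_pos _).le
  have h0 : A 0 = 0 := by simp [hA]
  have hY0 : Y 0 = y 0 := by simp [hY]
  have hYt : Y t = y t := (hy t ht).symm
  rw [hftc, h0, hY0, hYt, neg_zero, Real.exp_zero, one_mul] at hmono
  have e : ∫ s in (0 : ℝ)..t, Real.exp (A t - A s) * f s
      = Real.exp (A t) * ∫ s in (0 : ℝ)..t, Real.exp (-A s) * f s := by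
    rw [← intervalIntegral.integral_const_mul]
    congr 1 with s
    rw [sub_eq_add_neg, Real.exp_add, mul_assoc]
  rw [e]
  have hpos := Real.exp_pos (A t)
  have hinv : Real.exp (A t) * Real.exp (-A t) = 1 := by rw [← Real.exp_add]; simp
  have := mul_le_mul_of_nonneg_left hmono hpos.le
  rw [mul_sub, ← mul_assoc, hinv, one_mul] at this
  linarith

end Gronwall

end LinNS

end

/-! ### The estimate for the linearized system -/

theorem proposition3p1
    (Ω : Set LinNS.E) (hΩ : IsOpen Ω)
    (T : ℝ) (hT : 0 < T) (μ : ℝ) (hμ : 0 < μ)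
    (cP cL : ℝ) (hcP : LinNS.IsPoincareConst Ω cP) (hcL : LinNS.IsLadyzhenskayaConst Ω cL)
    (α : ℝ → ℝ) (hα : LinNS.IsPorosity α)
    (φ : LinNS.E → ℝ) (hφ : φ ∈ LinNS.PhiAd Ω)
    (F : ℝ → LinNS.L2 Ω) (hF : MemLp F 2 (LinNS.timeMeas T))
    (u₁ u₂ : ℝ → LinNS.L4 Ω)
    (hu₁ : MemLp u₁ 4 (LinNS.timeMeas T)) (hu₂ : MemLp u₂ 4 (LinNS.timeMeas T))
    (hdiv : ∀ᵐ t ∂(LinNS.timeMeas T), LinNS.IsDivFree Ω (u₂ t))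
    (G₁ : ℝ → LinNS.L2Mat Ω)
    (hG₁ : ∀ᵐ t ∂(LinNS.timeMeas T), LinNS.IsWeakGrad Ω (u₁ t) (G₁ t))
    (z : ℝ → LinNS.L2 Ω) (hz : MemLp z 2 (LinNS.timeMeas T))
    (hbound : ∀ᵐ t ∂(LinNS.timeMeas T), ‖G₁ t‖ ^ 2 ≤ ‖z t‖ ^ 2)
    (u₀ : LinNS.L2 Ω) (hu₀ : LinNS.IsH Ω u₀)
    (u : ℝ → LinNS.V Ω) (hu : LinNS.IsWeakSolution Ω T μ α φ G₁ u₂ F u₀ u) :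
    ∃ w : ℝ → LinNS.L2 Ω,
      ContinuousOn w (Icc 0 T) ∧ (∀ᵐ t ∂(LinNS.timeMeas T), w t = LinNS.fld (u t)) ∧ w 0 = u₀ ∧
      ∀ t ∈ Icc 0 T,
        ‖w t‖ ^ 2 ≤ Real.exp (LinNS.expA μ cP cL z t) * ‖u₀‖ ^ 2
          + 2 * cP ^ 2 / μ * ∫ τ in (0 : ℝ)..t,
              Real.exp (LinNS.expA μ cP cL z t - LinNS.expA μ cP cL z τ) * ‖F τ‖ ^ 2 := by
  obtain ⟨huL2, ⟨u', hu'L2, hweak, heq⟩, hinit⟩ := hu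
  set R := (InnerProductSpace.toDual ℝ (LinNS.V Ω)).symm with hR
  have hgL2 : MemLp (fun t => R (u' t)) 2 (LinNS.timeMeas T) := by
    exact MemLp.of_le (F := StrongDual ℝ (LinNS.V Ω)) hu'L2
      (R.continuous.comp_aestronglyMeasurable hu'L2.1)
      (Eventually.of_forall fun t => (R.norm_map _).le)
  have hRu : ∀ t ψ, inner ℝ (R (u' t)) ψ = u' t ψ := fun t ψ =>
    InnerProductSpace.toDual_symm_apply
  obtain ⟨w, hwc, hwu, hwE⟩ := LinNS.exists_continuous_representative hT (LinNS.fldL Ω)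
    (LinNS.fldL_injective hΩ) huL2 hgL2 (fun ψ η hη => by
      have := hweak ψ η hη
      simp only [LinNS.ip_eq_inner] at this
      simpa only [hRu, LinNS.fldL_apply] using this)
  have hw0 : w 0 = u₀ := by
    -- Every `(0,b)` has positive measure, so this filter is proper and limits along it are unique;
    -- along it `w` tends to both `w 0` and `u₀`.
    have hne : (𝓝[>] (0 : ℝ) ⊓ ae volume).NeBot := by
      refine Filter.inf_neBot_iff.2 fun s hs s' hs' => ?_
      obtain ⟨b, hb, hbs⟩ := mem_nhdsGT_iff_exists_Ioo_subset.1 hs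
      by_contra hcon
      have hsub : Ioo 0 b ⊆ s'ᶜ := fun x hx hx' => hcon ⟨x, hbs hx, hx'⟩
      have h0 := measure_mono_null hsub (mem_ae_iff.1 hs')
      rw [Real.volume_Ioo, sub_zero, ENNReal.ofReal_eq_zero] at h0
      exact absurd hb (not_lt.2 h0)
    have hev : ∀ᶠ t in 𝓝[>] (0 : ℝ) ⊓ ae volume, t ∈ Ioo 0 T ∧ w t = LinNS.fld (u t) := by
      have h1 : ∀ᶠ t in 𝓝[>] (0 : ℝ) ⊓ ae volume, t ∈ Ioo 0 T :=
        Filter.Eventually.filter_mono inf_le_left (Ioo_mem_nhdsGT hT)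
      have h2 : ∀ᶠ t in 𝓝[>] (0 : ℝ) ⊓ ae volume, t ∈ Ioo 0 T → w t = LinNS.fld (u t) :=
        Filter.Eventually.filter_mono inf_le_right ((ae_restrict_iff' measurableSet_Ioo).1 hwu)
      filter_upwards [h1, h2] with t h3 h4 using ⟨h3, h4 h3⟩
    have hlim1 : Tendsto w (𝓝[>] (0 : ℝ) ⊓ ae volume) (𝓝 (w 0)) := by
      have hc0 : Tendsto w (𝓝[Icc 0 T] 0) (𝓝 (w 0)) := hwc 0 ⟨le_rfl, hT.le⟩
      refine hc0.mono_left ?_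
      refine le_inf (inf_le_left.trans nhdsWithin_le_nhds) (le_principal_iff.2 ?_)
      filter_upwards [hev] with t ht using Ioo_subset_Icc_self ht.1
    refine tendsto_nhds_unique hlim1 (hinit.congr' ?_)
    filter_upwards [hev] with t ht using ht.2.symm
  refine ⟨w, hwc, hwu, hw0, fun t ht => ?_⟩
  have hI : ∀ {f : ℝ → ℝ}, Integrable f (LinNS.timeMeas T) → IntervalIntegrable f volume 0 T :=
    fun hf => (intervalIntegrable_iff_integrableOn_Ioo_of_le hT.le).2 hf
  have hz2 : IntervalIntegrable (fun s => ‖z s‖ ^ 2) volume 0 T := hI (hz.integrable_norm_pow')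
  have hF2 : IntervalIntegrable (fun s => ‖F s‖ ^ 2) volume 0 T := hI (hF.integrable_norm_pow')
  have hpair : IntervalIntegrable (fun s => 2 * inner ℝ (u s) (R (u' s))) volume 0 T :=
    hI (((huL2.norm.integrable_mul hgL2.norm).mono' (huL2.1.inner hgL2.1)
      (Eventually.of_forall fun s => norm_inner_le_norm _ _)).const_mul 2)
  have hA : ∀ s ∈ Icc 0 T, ∫ x in (0 : ℝ)..s, (2 * cL ^ 2 / μ * ‖z x‖ ^ 2 - μ / cP ^ 2)
      = LinNS.expA μ cP cL z s := by
    intro s hs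
    have hzs : IntervalIntegrable (fun s => ‖z s‖ ^ 2) volume 0 s :=
      hz2.mono_set (uIcc_subset_uIcc left_mem_uIcc (by rwa [uIcc_of_le hT.le]))
    rw [intervalIntegral.integral_sub (hzs.const_mul _) intervalIntegrable_const,
      intervalIntegral.integral_const_mul, intervalIntegral.integral_const, LinNS.expA]
    simp [mul_comm]
  -- For almost every time the equation holds for all test fields at once, so it may be tested with
  -- `u s`.
  have hG := LinNS.gronwall_of_integral (y := fun s => ‖w s‖ ^ 2) hpair
    ((hz2.const_mul (2 * cL ^ 2 / μ)).sub (intervalIntegrable_const (c := μ / cP ^ 2)))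
    (hF2.const_mul (2 * cP ^ 2 / μ))
    (fun s hs => by rw [intervalIntegral.integral_const_mul]; exact hwE s hs) (by
      filter_upwards [hwu, heq, hdiv, hbound] with s h1 h2 h3 h4
      rw [h1, real_inner_comm, hRu]
      exact LinNS.energy_inequality hμ hcP hcL hα.nonneg φ h3 h4 (h2 (u s))) ht
  rw [hw0, hA t ht] at hG
  refine hG.trans_eq ?_
  congr 1
  rw [← intervalIntegral.integral_const_mul]
  refine intervalIntegral.integral_congr fun s hs => ?_
  rw [uIcc_of_le ht.1] at hs
  rw [hA s ⟨hs.1, hs.2.trans ht.2⟩]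
  ring
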